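/- Let $\mathcal F$ be a finite family of finite sets that is union-closed, i.e. $A,B\in\mathcal F$ implies $A\cup B\in\mathcal F$, and suppose that its ground set $\bigcup_{A\in\mathcal F}A$ has at least $2$ elements. List the elements of the ground set in decreasing order of the number of members of $\mathcal F$ that contain them, and let $f_2(\mathcal F)$ be the proportion of the members of $\mathcal F$ that contain the second element of this list. Call $\mathcal F$ a near-$2$-cube if $\mathcal F=\{\varnothing,\{x\},U\}$ for some element $x$ and some finite set $U\supsetneq\{x\}$. For a most frequent element $x$ of the ground set, call a finite set $S$ $2$-good (with respect to $x$) if $x\notin S$ and $S\cap A\neq\varnothing$ for every $A\in\mathcal F$ other than $\varnothing$ and $\{x\}$; a $2$-good set is minimal if none of its proper subsets is $2$-good. If $\mathcal F$ is not a near-$2$-cube and $f_2(\mathcal F)\le\frac13$, then (i) $81\le|\mathcal F|\le 113$, and (ii) for every choice of a most frequent element $x$, every minimal $2$-good set with respect to $x$ has exactly $4$ elements. -/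

import Mathlib

open Finset

/-- The ground set `⋃ F` of a finite family of finite sets. -/
def groundSet {α : Type*} [DecidableEq α] (F : Finset (Finset α)) : Finset α :=
  F.biUnion id

/-- The number of sets of `F` that contain `x`. -/
def setCount {α : Type*} [DecidableEq α] (F : Finset (Finset α)) (x : α) : ℕ :=
  #{A ∈ F | x ∈ A}

/-- The counts of the elements of the ground set, with multiplicity, in decreasing order. -/
def sortedCounts {α : Type*} [DecidableEq α] (F : Finset (Finset α)) : List ℕ :=
  ((groundSet F).val.map (setCount F)).sort (· ≥ ·)

/-- The proportion `f_k(F)` of the sets of `F` that contain the `k`-th most frequent element of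
the ground set (`1 ≤ k ≤ #(groundSet F)`; ties are counted with multiplicity). -/
def kthFrequency {α : Type*} [DecidableEq α] (k : ℕ) (F : Finset (Finset α)) : ℚ :=
  ((sortedCounts F).getD (k - 1) 0 : ℚ) / (#F : ℚ)

/-- `F` is a near-2-cube: the power set `{∅, {x}}` of a one-element set together with one further
set `U` that properly contains `{x}`. -/
def IsNearTwoCube {α : Type*} [DecidableEq α] (F : Finset (Finset α)) : Prop :=
  ∃ (x : α) (U : Finset α), {x} ⊂ U ∧ F = {∅, {x}, U}

/-- `x` is a most frequent element of the ground set of `F`. -/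
def IsMostFrequent {α : Type*} [DecidableEq α] (F : Finset (Finset α)) (x : α) : Prop :=
  x ∈ groundSet F ∧ ∀ y ∈ groundSet F, setCount F y ≤ setCount F x

/-- `S` is 2-good for `F`, where `x` is the chosen most frequent element: `S` avoids `x` and meets
every set of `F` other than `∅` and `{x}`. -/
def IsTwoGood {α : Type*} [DecidableEq α] (F : Finset (Finset α)) (x : α) (S : Finset α) : Prop :=
  x ∉ S ∧ ∀ A ∈ F, A ≠ ∅ → A ≠ {x} → S ∩ A ≠ ∅

/-- `S` is a minimal 2-good set: no proper subset of `S` is 2-good. -/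
def IsMinimalTwoGood {α : Type*} [DecidableEq α] (F : Finset (Finset α)) (x : α)
    (S : Finset α) : Prop :=
  IsTwoGood F x S ∧ ∀ T : Finset α, T ⊂ S → ¬ IsTwoGood F x T

/-!
Let `x` be a most frequent element. Every other element then lies in at most a third of the
members of `F`.

*Upper bound.* Let `A` and `B` be independent uniform members of `F`. The union `A ∪ B` is a member
again, so its entropy is at most `log #F`. Reveal the elements one by one: `i ∉ A ∪ B` means
`i ∉ A` and `i ∉ B`, and an inequality for the entropy of the product of two independent bits shows
that each `i` contributes at least `8 / 5 * P(i ∉ A)` times as much entropy to `A ∪ B` as to `A`.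
This factor exceeds `1` for all `i ≠ x`, and the single element `x` accounts for a bounded loss, so
`log #F` is bounded. If all elements other than `x` have frequency at most `8 / 25`, the bound is
`113`; if some `y ≠ x` is more frequent than that, `A ∪ B` is far from uniform, which Gibbs'
inequality turns into a saving that gives `113` again.

*Lower bound.* Let `S` be a minimal `2`-good set. By minimality every one-point subset of `S` is the
trace of a member, so by union-closure every nonempty `T ⊆ S` is. Counting the incidences between
`F` and `S` in two ways, each point of `S` lying in at most `#F / 3` members, leaves room for few
repeated traces when `#F` is small, and forces many members to have a trace of size at most one.
Three members with the trace `{i}` are distinguished by some `w ≠ x`, and `w` also repeats larger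
traces containing `i`. Weighing these repetitions rules out every size of `S` other than `4`
(given `#F ≤ 113`) and yields `81 ≤ #F` for size `4`.
-/

section BinaryEntropy

open Real

lemma two_mul_le_neg_log_one_sub {t : ℝ} (h₀ : 0 ≤ t) (h₁ : t < 1) :
    2 * (t / (2 - t) + (t / (2 - t)) ^ 3 / 3) ≤ -log (1 - t) := by
  have h2 : 2 - t ≠ 0 := by linarith
  have hmobius : (1 + t / (2 - t)) / (1 - t / (2 - t)) = (1 - t)⁻¹ := by
    have h1 : 1 - t ≠ 0 := by linarith
    rw [one_add_div h2, one_sub_div h2, div_div_div_cancel_right₀ h2, inv_eq_one_div,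
      div_eq_div_iff (by linarith) h1]
    ring
  have h := sum_range_le_log_div (x := t / (2 - t)) (div_nonneg h₀ (by linarith))
    (by rw [div_lt_one (by linarith)]; linarith) 2
  rw [hmobius, log_inv] at h
  norm_num [sum_range_succ] at h
  linarith

lemma log_one_add_le {t : ℝ} (h₀ : 0 ≤ t) :
    log (1 + t) ≤ 2 * (t / (2 + t) + (t / (2 + t)) ^ 3 / 3) +
      t ^ 5 / (2 * (2 + t) ^ 3 * (1 + t)) := by
  have h2 : 2 + t ≠ 0 := by positivity
  have hmobius : (1 + t / (2 + t)) / (1 - t / (2 + t)) = 1 + t := by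
    rw [one_add_div h2, one_sub_div h2, div_div_div_cancel_right₀ h2, div_eq_iff (by norm_num)]
    ring
  have h := log_div_le_sum_range_add (x := t / (2 + t)) (by positivity)
    (by rw [div_lt_one (by positivity)]; linarith) 2
  rw [hmobius] at h
  norm_num [sum_range_succ] at h
  have htail : (t / (2 + t)) ^ 5 / (1 - (t / (2 + t)) ^ 2) =
      t ^ 5 / (4 * (2 + t) ^ 3 * (1 + t)) := by
    have hsq : 1 - (t / (2 + t)) ^ 2 = 4 * (1 + t) / (2 + t) ^ 2 := by
      field_simp
      ring
    rw [hsq]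
    field_simp
  rw [htail] at h
  have hhalf : t ^ 5 / (2 * (2 + t) ^ 3 * (1 + t)) =
      2 * (t ^ 5 / (4 * (2 + t) ^ 3 * (1 + t))) := by
    field_simp
    norm_num
  linarith

lemma rational_bound_of_binEntropy_sq {t : ℝ} (h₀ : 0 ≤ t) (h₁ : t ≤ 1) :
    (1 + t) * (2 * (t / (2 + t) + (t / (2 + t)) ^ 3 / 3) + t ^ 5 / (2 * (2 + t) ^ 3 * (1 + t))) ≤
      4 / 5 * (t ^ 2 / (1 + t)) +
        (1 - 3 / 5 * t) * (2 * (t / (2 - t) + (t / (2 - t)) ^ 3 / 3)) := by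
  have h2 : 0 < 2 - t := by linarith
  have _ : 0 ≤ 1 - t := by linarith
  rw [← sub_nonneg]
  -- The polynomial in the numerator is written in the Bernstein basis of degree 7.
  calc (0 : ℝ) ≤ t ^ 2 * (384 * (1 - t) ^ 7 + 1920 * t * (1 - t) ^ 6 + 3488 * t ^ 2 * (1 - t) ^ 5
          + 2664 * t ^ 3 * (1 - t) ^ 4 + 764 * t ^ 4 * (1 - t) ^ 3 + 350 * t ^ 5 * (1 - t) ^ 2
          + 389 * t ^ 6 * (1 - t) + 106 * t ^ 7) / (30 * (1 + t) * (2 - t) ^ 3 * (2 + t) ^ 3) := by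
        positivity
    _ = _ := by
        field_simp
        ring

/-- The optimal constant is the golden ratio; `8 / 5` is enough below and leaves room for the
rational bounds on the logarithms. -/
lemma binEntropy_sq_ge {t : ℝ} (h₀ : 0 < t) (h₁ : t < 1) :
    8 / 5 * (t * binEntropy t) ≤ binEntropy (t ^ 2) := by
  have hlog : 2 * ((1 - t) / (1 + t)) ≤ -log t := by
    have h := le_log_one_add_of_nonneg (x := (1 - t) / t) (div_nonneg (by linarith) h₀.le)
    have hinv : 1 + (1 - t) / t = t⁻¹ := by
      field_simp
      ring
    have hadd : (1 - t) / t + 2 = (1 + t) / t := by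
      field_simp
      ring
    rwa [hinv, log_inv, hadd, mul_div_assoc, div_div_div_cancel_right₀ h₀.ne'] at h
  have hlogsq : log (1 - t ^ 2) = log (1 - t) + log (1 + t) := by
    rw [← log_mul (by linarith) (by linarith)]
    ring_nf
  have hterm₁ := mul_le_mul_of_nonneg_left hlog (show 0 ≤ 2 / 5 * t ^ 2 by positivity)
  have hterm₂ := mul_le_mul_of_nonneg_left (two_mul_le_neg_log_one_sub h₀.le h₁)
    (show 0 ≤ (1 - t) * (1 - 3 / 5 * t) from mul_nonneg (by linarith) (by linarith))
  have hterm₃ := mul_le_mul_of_nonneg_left (log_one_add_le h₀.le)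
    (show 0 ≤ (1 - t) * (1 + t) from mul_nonneg (by linarith) (by linarith))
  have hbound := mul_le_mul_of_nonneg_left (rational_bound_of_binEntropy_sq h₀.le h₁.le)
    (show 0 ≤ 1 - t by linarith)
  have hrat : 2 / 5 * t ^ 2 * (2 * ((1 - t) / (1 + t))) =
      (1 - t) * (4 / 5 * (t ^ 2 / (1 + t))) := by ring
  simp only [binEntropy, log_inv, hlogsq, log_pow]
  push_cast
  linarith

lemma neg_log_one_sub_div_mono {s t : ℝ} (hs : 0 < s) (hst : s ≤ t) (ht : t < 1) :
    -log (1 - s) / s ≤ -log (1 - t) / t := by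
  have h := strictConcaveOn_log_Ioi.concaveOn.neg.secant_mono (a := 1) (x := 1 - t) (y := 1 - s)
    (by simp) (by simpa using ht) (by simpa using hst.trans_lt ht) (by linarith) (by linarith)
    (by linarith)
  simp only [Pi.neg_apply, log_one, neg_zero, sub_zero, sub_sub_cancel_left] at h
  rw [div_neg, div_neg, neg_le_neg_iff] at h
  exact h

lemma concaveOn_binEntropy_exp_neg_div :
    ConcaveOn ℝ (Set.Ioi 0) fun a : ℝ => binEntropy (exp (-a)) / exp (-a) := by
  have hlt : ∀ a ∈ Set.Ioi (0 : ℝ), exp (-a) < 1 := fun a ha =>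
    exp_lt_one_iff.2 (neg_lt_zero.2 ha)
  have hderiv : ∀ a ∈ Set.Ioi (0 : ℝ), HasDerivAt (fun a => binEntropy (exp (-a)) / exp (-a))
      (-log (1 - exp (-a)) / exp (-a)) a := by
    intro a ha
    have hexp : HasDerivAt (fun a : ℝ => exp (-a)) (-exp (-a)) a := by
      simpa only [mul_neg_one] using (hasDerivAt_neg a).exp
    have hcomp := (hasDerivAt_binEntropy (exp_pos _).ne' (hlt a ha).ne).comp a hexp
    refine (hcomp.div hexp (exp_pos _).ne').congr_deriv ?_
    simp only [Function.comp_apply, binEntropy, log_inv, log_exp]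
    field_simp
    ring
  refine AntitoneOn.concaveOn_of_deriv (convex_Ioi 0)
    (fun a ha => (hderiv a ha).continuousAt.continuousWithinAt) ?_ ?_ <;> rw [interior_Ioi]
  · exact fun a ha => (hderiv a ha).differentiableAt.differentiableWithinAt
  · intro a ha b hb hab
    rw [(hderiv a ha).deriv, (hderiv b hb).deriv]
    exact neg_log_one_sub_div_mono (exp_pos _) (exp_le_exp.2 (neg_le_neg hab)) (hlt a ha)

lemma binEntropy_div_add_le {p q : ℝ} (hp₀ : 0 < p) (hp₁ : p < 1) (hq₀ : 0 < q) (hq₁ : q < 1) :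
    binEntropy p / p + binEntropy q / q ≤ 2 * (binEntropy √(p * q) / √(p * q)) := by
  have h := concaveOn_binEntropy_exp_neg_div.2 (x := -log p) (y := -log q)
    (neg_pos.2 (log_neg hp₀ hp₁)) (neg_pos.2 (log_neg hq₀ hq₁)) one_half_pos.le one_half_pos.le
    (add_halves 1)
  have hsqrt : exp (-(1 / 2 * -log p + 1 / 2 * -log q)) = √(p * q) := by
    rw [sqrt_eq_rpow, rpow_def_of_pos (mul_pos hp₀ hq₀), log_mul hp₀.ne' hq₀.ne']
    ring_nf
  simp only [neg_neg, exp_log hp₀, exp_log hq₀, smul_eq_mul, hsqrt] at h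
  linarith

/-- On the logarithmic scale `binEntropy p / p` is concave, so replacing `p` and `q` by their
geometric mean reduces to the diagonal. -/
lemma binEntropy_mul_ge {p q : ℝ} (hp₀ : 0 ≤ p) (hp₁ : p ≤ 1) (hq₀ : 0 ≤ q) (hq₁ : q ≤ 1) :
    4 / 5 * (p * binEntropy q + q * binEntropy p) ≤ binEntropy (p * q) := by
  rcases hp₀.eq_or_lt with rfl | hp₀
  · simp
  rcases hq₀.eq_or_lt with rfl | hq₀
  · simp
  rcases hp₁.eq_or_lt with rfl | hp₁
  · have := binEntropy_nonneg hq₀.le hq₁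
    rw [binEntropy_one, one_mul, one_mul, mul_zero]
    linarith
  rcases hq₁.eq_or_lt with rfl | hq₁
  · have := binEntropy_nonneg hp₀.le hp₁.le
    rw [binEntropy_one, mul_one, one_mul, mul_zero]
    linarith
  have hpq : 0 < p * q := mul_pos hp₀ hq₀
  have hsqrt₁ : √(p * q) < 1 := by
    rw [sqrt_lt' one_pos, one_pow]
    exact mul_lt_one_of_nonneg_of_lt_one_left hp₀.le hp₁ hq₁.le
  calc 4 / 5 * (p * binEntropy q + q * binEntropy p)
      = 4 / 5 * (p * q * (binEntropy p / p + binEntropy q / q)) := by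
        field_simp
        ring
    _ ≤ 4 / 5 * (p * q * (2 * (binEntropy √(p * q) / √(p * q)))) := by
        gcongr
        exact binEntropy_div_add_le hp₀ hp₁ hq₀ hq₁
    _ = 8 / 5 * (√(p * q) * binEntropy √(p * q)) := by
        nth_rw 1 [← mul_self_sqrt hpq.le]
        field_simp
        ring
    _ ≤ binEntropy (√(p * q) ^ 2) := binEntropy_sq_ge (sqrt_pos.2 hpq) hsqrt₁
    _ = binEntropy (p * q) := by rw [sq_sqrt hpq.le]

lemma negMulLog_le_neg_mul_log_add {v q : ℝ} (hv : 0 ≤ v) (hq : 0 < q) :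
    negMulLog v ≤ -(v * log q) + (q - v) := by
  rcases hv.eq_or_lt with rfl | hv
  · simpa using hq.le
  have h := mul_le_mul_of_nonneg_left (log_le_sub_one_of_pos (div_pos hq hv)) hv.le
  rw [log_div hq.ne' hv.ne', mul_sub, mul_sub_one, mul_div_cancel₀ _ hv.ne'] at h
  rw [negMulLog]
  linarith

lemma negMulLog_add_negMulLog_sub {m u : ℝ} (hu : 0 ≤ u) (hum : u ≤ m) :
    negMulLog u + negMulLog (m - u) = negMulLog m + m * binEntropy (u / m) := by
  rcases (hu.trans hum).eq_or_lt with rfl | hm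
  · simp [le_antisymm hum hu]
  have hsub : m * (1 - u / m) = m - u := by field_simp
  have hu' := negMulLog_mul m (u / m)
  have hsub' := negMulLog_mul m (1 - u / m)
  rw [mul_div_cancel₀ _ hm.ne'] at hu'
  rw [hsub] at hsub'
  rw [hu', hsub', binEntropy_eq_negMulLog_add_negMulLog_one_sub]
  ring

/-- Conditioning reduces the entropy of a bit. -/
lemma sum_mul_binEntropy_div_le {ι : Type*} (s : Finset ι) (m u : ι → ℝ) (hu : ∀ i ∈ s, 0 ≤ u i)
    (hum : ∀ i ∈ s, u i ≤ m i) :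
    ∑ i ∈ s, m i * binEntropy (u i / m i)
      ≤ (∑ i ∈ s, m i) * binEntropy ((∑ i ∈ s, u i) / ∑ i ∈ s, m i) := by
  have hm : ∀ i ∈ s, 0 ≤ m i := fun i hi => (hu i hi).trans (hum i hi)
  rcases (sum_nonneg hm).eq_or_lt with h0 | hpos
  · rw [← h0, zero_mul]
    exact (sum_eq_zero fun i hi => by
      rw [(sum_eq_zero_iff_of_nonneg hm).1 h0.symm i hi, zero_mul]).le
  have hJensen := strictConcave_binEntropy.concaveOn.le_map_centerMass (t := s) (w := m)
    (p := fun i => u i / m i) hm hpos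
    fun i hi => ⟨div_nonneg (hu i hi) (hm i hi), div_le_one_of_le₀ (hum i hi) (hm i hi)⟩
  have hcancel : ∀ i ∈ s, m i * (u i / m i) = u i := fun i hi =>
    mul_div_cancel_of_imp' fun h => le_antisymm (h ▸ hum i hi) (hu i hi)
  simp only [centerMass, Function.comp_apply, smul_eq_mul, sum_congr rfl hcancel] at hJensen
  rwa [inv_mul_le_iff₀ hpos, inv_mul_eq_div] at hJensen

lemma mul_mul_binEntropy_div_ge {m u m' u' : ℝ} (hu : 0 ≤ u) (hum : u ≤ m) (hu' : 0 ≤ u')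
    (hum' : u' ≤ m') :
    4 / 5 * (u * (m' * binEntropy (u' / m')) + u' * (m * binEntropy (u / m)))
      ≤ m * m' * binEntropy (u * u' / (m * m')) := by
  rcases (hu.trans hum).eq_or_lt with rfl | hm
  · simp [le_antisymm hum hu]
  rcases (hu'.trans hum').eq_or_lt with rfl | hm'
  · simp [le_antisymm hum' hu']
  have h := mul_le_mul_of_nonneg_left (binEntropy_mul_ge (div_nonneg hu hm.le)
    (div_le_one_of_le₀ hum hm.le) (div_nonneg hu' hm'.le) (div_le_one_of_le₀ hum' hm'.le))
    (mul_pos hm hm').le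
  rw [div_mul_div_comm] at h
  refine le_of_eq_of_le ?_ h
  field_simp

/-- The tangent line at `1 / 4`, with rounded coefficients. -/
lemma binEntropy_le_affine {q : ℝ} (h₀ : 0 ≤ q) (h₁ : q ≤ 1) :
    binEntropy q ≤ 11 / 10 * q + 29 / 100 := by
  have hq := negMulLog_le_neg_mul_log_add h₀ (show (0 : ℝ) < 1 / 4 by norm_num)
  have hq' := negMulLog_le_neg_mul_log_add (sub_nonneg.2 h₁) (show (0 : ℝ) < 3 / 4 by norm_num)
  have hlog₁ : log (1 / 4) = -(2 * log 2) := by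
    rw [one_div, log_inv, log_four_eq]
  have hlog₃ : log (3 / 4) = log 3 - 2 * log 2 := by
    rw [log_div (by norm_num) (by norm_num), log_four_eq]
  have hlog3 := mul_le_mul_of_nonneg_left log_three_lt_d9.le h₀
  rw [binEntropy_eq_negMulLog_add_negMulLog_one_sub]
  rw [hlog₁] at hq
  rw [hlog₃] at hq'
  linarith [log_two_lt_d9, log_three_gt_d9]

lemma sub_mul_binEntropy_le {q : ℝ} (r : ℝ) (h₀ : 0 ≤ q) (h₁ : q ≤ 1) :
    (r - q) * binEntropy q ≤ (11 / 10 * r + 29 / 100) ^ 2 / (22 / 5) := by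
  rcases le_total r q with hrq | hqr
  · exact (mul_nonpos_of_nonpos_of_nonneg (sub_nonpos.2 hrq) (binEntropy_nonneg h₀ h₁)).trans
      (by positivity)
  · have h := mul_le_mul_of_nonneg_left (binEntropy_le_affine h₀ h₁) (sub_nonneg.2 hqr)
    linarith [sq_nonneg (11 / 10 * r - 29 / 100 - 11 / 5 * q)]

lemma lt_log_of_114_le {n : ℕ} (h : 114 ≤ n) : 47 / 10 < log n :=
  calc (47 / 10 : ℝ) < 10 * log 2 - 2 * log 3 := by
        linarith [log_two_gt_d9, log_three_lt_d9]
    _ = log (2 ^ 10 / 3 ^ 2) := by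
        rw [log_div (by norm_num) (by norm_num), log_pow, log_pow]
        norm_num
    _ ≤ log n := log_le_log (by norm_num)
        (le_trans (by norm_num) (Nat.cast_le (α := ℝ).2 h))

end BinaryEntropy

section UniformEntropy

variable {β β₁ β₂ γ δ γ₁ γ₂ : Type*} [DecidableEq γ] [DecidableEq δ] [DecidableEq γ₁]
  [DecidableEq γ₂]

/-- The probability of the event `p` for a uniformly distributed element of the finite set `Ω`;
it is `0` if `Ω` is empty. -/
noncomputable def uniformProb (Ω : Finset β) (p : β → Prop) [DecidablePred p] : ℝ :=
  #{ω ∈ Ω | p ω} / #Ω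

/-- The Shannon entropy (in nats) of the random variable `g` on the finite set `Ω` with the uniform
distribution. -/
noncomputable def uniformEntropy (Ω : Finset β) (g : β → γ) : ℝ :=
  ∑ c ∈ Ω.image g, Real.negMulLog (uniformProb Ω (g · = c))

/-- The conditional entropy (in nats) of the indicator of the event `p` given the random variable
`g`, for the uniform distribution on the finite set `Ω`. -/
noncomputable def condEventEntropy (Ω : Finset β) (p : β → Prop) [DecidablePred p] (g : β → γ) :
    ℝ :=
  ∑ c ∈ Ω.image g, uniformProb Ω (g · = c) *
    Real.binEntropy (uniformProb Ω (fun ω => g ω = c ∧ p ω) / uniformProb Ω (g · = c))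

lemma uniformProb_nonneg (Ω : Finset β) (p : β → Prop) [DecidablePred p] :
    0 ≤ uniformProb Ω p := by
  unfold uniformProb
  positivity

lemma uniformProb_mono (Ω : Finset β) {p q : β → Prop} [DecidablePred p] [DecidablePred q]
    (h : ∀ ω, p ω → q ω) : uniformProb Ω p ≤ uniformProb Ω q := by
  unfold uniformProb
  gcongr with ω
  exact h ω

lemma uniformProb_and_add_and_not (Ω : Finset β) (p q : β → Prop) [DecidablePred p]
    [DecidablePred q] :
    uniformProb Ω (fun ω => p ω ∧ q ω) + uniformProb Ω (fun ω => p ω ∧ ¬q ω) = uniformProb Ω p := by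
  simp only [uniformProb, ← filter_filter]
  rw [← add_div, ← Nat.cast_add, card_filter_add_card_filter_not]

lemma sum_uniformProb_and_eq (Ω : Finset β) (p : β → Prop) [DecidablePred p] {g : β → γ}
    {t : Finset γ} (h : ∀ ω ∈ Ω, p ω → g ω ∈ t) :
    ∑ c ∈ t, uniformProb Ω (fun ω => g ω = c ∧ p ω) = uniformProb Ω p := by
  simp only [uniformProb, and_comm (b := p _), ← filter_filter]
  rw [← sum_div, ← Nat.cast_sum, ← card_eq_sum_card_fiberwise]
  intro ω hω
  obtain ⟨hω, hp⟩ := mem_filter.1 hω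
  exact h ω hω hp

lemma uniformProb_product (Ω₁ : Finset β₁) (Ω₂ : Finset β₂) (p₁ : β₁ → Prop) (p₂ : β₂ → Prop)
    [DecidablePred p₁] [DecidablePred p₂] :
    uniformProb (Ω₁ ×ˢ Ω₂) (fun z => p₁ z.1 ∧ p₂ z.2) = uniformProb Ω₁ p₁ * uniformProb Ω₂ p₂ := by
  simp only [uniformProb]
  rw [filter_product, card_product, card_product, div_mul_div_comm, Nat.cast_mul, Nat.cast_mul]

lemma uniformProb_eq_zero {Ω : Finset β} {p : β → Prop} [DecidablePred p] (h : ∀ ω ∈ Ω, ¬p ω) :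
    uniformProb Ω p = 0 := by
  rw [uniformProb, filter_false_of_mem h, card_empty, Nat.cast_zero, zero_div]

lemma uniformProb_eq_one {Ω : Finset β} (hΩ : Ω.Nonempty) {p : β → Prop} [DecidablePred p]
    (h : ∀ ω ∈ Ω, p ω) : uniformProb Ω p = 1 := by
  rw [uniformProb, filter_true_of_mem h, div_self (Nat.cast_ne_zero.2 hΩ.card_ne_zero)]

lemma uniformProb_not {Ω : Finset β} (hΩ : Ω.Nonempty) (p : β → Prop) [DecidablePred p] :
    uniformProb Ω (¬p ·) = 1 - uniformProb Ω p := by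
  have h := uniformProb_and_add_and_not Ω (fun _ => True) p
  simp only [true_and] at h
  linarith [uniformProb_eq_one hΩ (p := fun _ => True) fun _ _ => trivial]

lemma uniformProb_le_one (Ω : Finset β) (p : β → Prop) [DecidablePred p] :
    uniformProb Ω p ≤ 1 :=
  div_le_one_of_le₀ (Nat.cast_le.2 (card_filter_le _ _)) (Nat.cast_nonneg _)

lemma uniformEntropy_eq_sum {Ω : Finset β} {g : β → γ} {t : Finset γ} (ht : Ω.image g ⊆ t) :
    uniformEntropy Ω g = ∑ c ∈ t, Real.negMulLog (uniformProb Ω (g · = c)) := by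
  refine sum_subset ht fun c _ hc => ?_
  rw [uniformProb_eq_zero fun ω hω h => hc (mem_image.2 ⟨ω, hω, h⟩), Real.negMulLog_zero]

lemma uniformEntropy_congr {Ω : Finset β} {g g' : β → γ} (h : ∀ ω ∈ Ω, g ω = g' ω) :
    uniformEntropy Ω g = uniformEntropy Ω g' := by
  rw [uniformEntropy, uniformEntropy, image_congr h]
  refine sum_congr rfl fun c _ => ?_
  rw [uniformProb, uniformProb, filter_congr fun ω hω => by rw [h ω hω]]

lemma uniformEntropy_comp_of_injective (Ω : Finset β) (g : β → γ) {ψ : γ → δ}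
    (hψ : ψ.Injective) : uniformEntropy Ω (fun ω => ψ (g ω)) = uniformEntropy Ω g := by
  have himage : Ω.image (fun ω => ψ (g ω)) = (Ω.image g).image ψ := image_image.symm
  rw [uniformEntropy, himage, sum_image hψ.injOn]
  simp only [hψ.eq_iff, uniformEntropy]

lemma uniformEntropy_const (Ω : Finset β) (c : γ) : uniformEntropy Ω (fun _ => c) = 0 := by
  rcases Ω.eq_empty_or_nonempty with rfl | hΩ
  · rw [uniformEntropy, image_empty, sum_empty]
  · rw [uniformEntropy, image_const hΩ, sum_singleton, uniformProb_eq_one hΩ fun _ _ => rfl,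
      Real.negMulLog_one]

lemma uniformEntropy_of_injOn {Ω : Finset β} {g : β → γ} (hg : Set.InjOn g Ω) :
    uniformEntropy Ω g = Real.log #Ω := by
  rcases Ω.eq_empty_or_nonempty with rfl | hΩ
  · simp [uniformEntropy]
  have hprob : ∀ ω ∈ Ω, uniformProb Ω (g · = g ω) = (#Ω : ℝ)⁻¹ := by
    intro ω hω
    have hfiber : {ω' ∈ Ω | g ω' = g ω} = {ω} := by
      ext ω'
      rw [mem_filter, mem_singleton]
      exact ⟨fun h => hg h.1 hω h.2, fun h => ⟨h ▸ hω, h ▸ rfl⟩⟩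
    rw [uniformProb, hfiber, card_singleton, Nat.cast_one, one_div]
  have hcard : (#Ω : ℝ) ≠ 0 := Nat.cast_ne_zero.2 hΩ.card_ne_zero
  rw [uniformEntropy, sum_image hg, sum_congr rfl fun ω hω => by rw [hprob ω hω], sum_const,
    nsmul_eq_mul, Real.negMulLog, Real.log_inv]
  field_simp

lemma uniformEntropy_le_neg_sum_log {Ω : Finset β} {g : β → γ} {q : γ → ℝ}
    (hq : ∀ ω ∈ Ω, 0 < q (g ω)) (hsum : ∑ c ∈ Ω.image g, q c ≤ 1) :
    uniformEntropy Ω g ≤ -(∑ ω ∈ Ω, Real.log (q (g ω))) / #Ω := by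
  rcases Ω.eq_empty_or_nonempty with rfl | hΩ
  · simp [uniformEntropy]
  have hq' : ∀ c ∈ Ω.image g, 0 < q c := forall_mem_image.2 hq
  have hone : ∑ c ∈ Ω.image g, uniformProb Ω (g · = c) = 1 := by
    have h := sum_uniformProb_and_eq Ω (fun _ => True) fun ω hω _ => mem_image_of_mem g hω
    simp only [and_true] at h
    rw [h, uniformProb_eq_one hΩ fun _ _ => trivial]
  have hcross : ∑ c ∈ Ω.image g, uniformProb Ω (g · = c) * Real.log (q c) =
      (∑ ω ∈ Ω, Real.log (q (g ω))) / #Ω := by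
    rw [sum_comp (fun c => Real.log (q c)) g, sum_div]
    refine sum_congr rfl fun c _ => ?_
    rw [uniformProb, nsmul_eq_mul, div_mul_eq_mul_div]
  calc uniformEntropy Ω g
      ≤ ∑ c ∈ Ω.image g, (-(uniformProb Ω (g · = c) * Real.log (q c)) +
          (q c - uniformProb Ω (g · = c))) :=
        sum_le_sum fun c hc => negMulLog_le_neg_mul_log_add (uniformProb_nonneg _ _) (hq' c hc)
    _ = -(∑ ω ∈ Ω, Real.log (q (g ω))) / #Ω + (∑ c ∈ Ω.image g, q c - 1) := by
        rw [sum_add_distrib, sum_neg_distrib, sum_sub_distrib, hone, hcross, neg_div]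
    _ ≤ -(∑ ω ∈ Ω, Real.log (q (g ω))) / #Ω := by linarith

lemma condEventEntropy_eq_sum {Ω : Finset β} (p : β → Prop) [DecidablePred p] {g : β → γ}
    {t : Finset γ} (ht : Ω.image g ⊆ t) :
    condEventEntropy Ω p g = ∑ c ∈ t, uniformProb Ω (g · = c) *
      Real.binEntropy (uniformProb Ω (fun ω => g ω = c ∧ p ω) / uniformProb Ω (g · = c)) := by
  refine sum_subset ht fun c _ hc => ?_
  rw [uniformProb_eq_zero (p := (g · = c)) fun ω hω h => hc (mem_image.2 ⟨ω, hω, h⟩), zero_mul]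

lemma uniformEntropy_pair_decide (Ω : Finset β) (p : β → Prop) [DecidablePred p] (g : β → γ) :
    uniformEntropy Ω (fun ω => (g ω, decide (p ω))) =
      uniformEntropy Ω g + condEventEntropy Ω p g := by
  have himage : Ω.image (fun ω => (g ω, decide (p ω))) ⊆ Ω.image g ×ˢ univ := fun c hc => by
    obtain ⟨ω, hω, rfl⟩ := mem_image.1 hc
    exact mem_product.2 ⟨mem_image_of_mem g hω, mem_univ _⟩
  rw [uniformEntropy_eq_sum himage, sum_product, uniformEntropy, condEventEntropy,
    ← sum_add_distrib]
  refine sum_congr rfl fun c _ => ?_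
  rw [Fintype.sum_bool, ← negMulLog_add_negMulLog_sub (uniformProb_nonneg _ _)
    (uniformProb_mono Ω fun _ => And.left),
    ← eq_sub_of_add_eq' (uniformProb_and_add_and_not Ω (g · = c) p)]
  simp only [Prod.mk.injEq, decide_eq_true_eq, decide_eq_false_iff_not]

lemma condEventEntropy_const (Ω : Finset β) (p : β → Prop) [DecidablePred p] (c : γ) :
    condEventEntropy Ω p (fun _ => c) = Real.binEntropy (uniformProb Ω p) := by
  rcases Ω.eq_empty_or_nonempty with rfl | hΩ
  · simp [condEventEntropy, uniformProb]
  · rw [condEventEntropy, image_const hΩ, sum_singleton, uniformProb_eq_one hΩ fun _ _ => rfl]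
    simp only [true_and, one_mul, div_one]

lemma condEventEntropy_nonneg (Ω : Finset β) (p : β → Prop) [DecidablePred p] (g : β → γ) :
    0 ≤ condEventEntropy Ω p g :=
  sum_nonneg fun _ _ => mul_nonneg (uniformProb_nonneg _ _) <|
    Real.binEntropy_nonneg (div_nonneg (uniformProb_nonneg _ _) (uniformProb_nonneg _ _)) <|
      div_le_one_of_le₀ (uniformProb_mono Ω fun _ => And.left) (uniformProb_nonneg _ _)

lemma condEventEntropy_le_comp (Ω : Finset β) (p : β → Prop) [DecidablePred p] (g : β → γ)
    (φ : γ → δ) : condEventEntropy Ω p g ≤ condEventEntropy Ω p (fun ω => φ (g ω)) := by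
  have hmaps : ∀ c ∈ Ω.image g, φ c ∈ Ω.image (fun ω => φ (g ω)) := fun c hc => by
    obtain ⟨ω, hω, rfl⟩ := mem_image.1 hc
    exact mem_image_of_mem (fun ω => φ (g ω)) hω
  rw [condEventEntropy, ← sum_fiberwise_of_maps_to hmaps, condEventEntropy]
  refine sum_le_sum fun d _ => ?_
  have hfiber : ∀ (q : β → Prop) [DecidablePred q],
      ∑ c ∈ Ω.image g with φ c = d, uniformProb Ω (fun ω => g ω = c ∧ q ω) =
        uniformProb Ω (fun ω => φ (g ω) = d ∧ q ω) := by
    intro q _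
    rw [← sum_uniformProb_and_eq Ω (fun ω => φ (g ω) = d ∧ q ω) (g := g)
      (t := {c ∈ Ω.image g | φ c = d})
      fun ω hω h => mem_filter.2 ⟨mem_image_of_mem g hω, h.1⟩]
    refine sum_congr rfl fun c hc => ?_
    congr! 2 with ω
    exact and_congr_right fun h => by rw [h, (mem_filter.1 hc).2, eq_self, true_and]
  have h := sum_mul_binEntropy_div_le {c ∈ Ω.image g | φ c = d}
    (fun c => uniformProb Ω (g · = c)) (fun c => uniformProb Ω (fun ω => g ω = c ∧ p ω))
    (fun _ _ => uniformProb_nonneg _ _) fun _ _ => uniformProb_mono Ω fun _ => And.left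
  have htotal := hfiber fun _ => True
  simp only [and_true] at htotal
  rwa [hfiber, htotal] at h

lemma condEventEntropy_product_ge (Ω₁ : Finset β₁) (Ω₂ : Finset β₂) (p₁ : β₁ → Prop)
    (p₂ : β₂ → Prop) [DecidablePred p₁] [DecidablePred p₂] (g₁ : β₁ → γ₁) (g₂ : β₂ → γ₂) :
    4 / 5 * (uniformProb Ω₁ p₁ * condEventEntropy Ω₂ p₂ g₂ +
        uniformProb Ω₂ p₂ * condEventEntropy Ω₁ p₁ g₁) ≤
      condEventEntropy (Ω₁ ×ˢ Ω₂) (fun z => p₁ z.1 ∧ p₂ z.2) (fun z => (g₁ z.1, g₂ z.2)) := by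
  have himage : (Ω₁ ×ˢ Ω₂).image (fun z => (g₁ z.1, g₂ z.2)) ⊆ Ω₁.image g₁ ×ˢ Ω₂.image g₂ := by
    intro c hc
    obtain ⟨z, hz, rfl⟩ := mem_image.1 hc
    obtain ⟨hz₁, hz₂⟩ := mem_product.1 hz
    exact mem_product.2 ⟨mem_image_of_mem g₁ hz₁, mem_image_of_mem g₂ hz₂⟩
  rw [condEventEntropy_eq_sum _ himage, condEventEntropy, condEventEntropy,
    ← sum_uniformProb_and_eq Ω₁ p₁ fun ω hω _ => mem_image_of_mem g₁ hω,
    ← sum_uniformProb_and_eq Ω₂ p₂ fun ω hω _ => mem_image_of_mem g₂ hω,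
    sum_mul_sum, sum_mul_sum, sum_comm (s := Ω₂.image g₂), ← sum_product', ← sum_product',
    ← sum_add_distrib, mul_sum]
  refine sum_le_sum fun c _ => ?_
  have hpair : uniformProb (Ω₁ ×ˢ Ω₂) (fun z => (g₁ z.1, g₂ z.2) = c) =
      uniformProb Ω₁ (g₁ · = c.1) * uniformProb Ω₂ (g₂ · = c.2) := by
    simp only [Prod.ext_iff]
    exact uniformProb_product Ω₁ Ω₂ (g₁ · = c.1) (g₂ · = c.2)
  have hpair_and : uniformProb (Ω₁ ×ˢ Ω₂)
      (fun z => (g₁ z.1, g₂ z.2) = c ∧ p₁ z.1 ∧ p₂ z.2) =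
      uniformProb Ω₁ (fun ω => g₁ ω = c.1 ∧ p₁ ω) *
        uniformProb Ω₂ (fun ω => g₂ ω = c.2 ∧ p₂ ω) := by
    simp only [Prod.ext_iff, and_and_and_comm]
    exact uniformProb_product Ω₁ Ω₂ (fun ω => g₁ ω = c.1 ∧ p₁ ω) (fun ω => g₂ ω = c.2 ∧ p₂ ω)
  rw [hpair, hpair_and]
  exact mul_mul_binEntropy_div_ge (uniformProb_nonneg _ _)
    (uniformProb_mono Ω₁ fun _ => And.left) (uniformProb_nonneg _ _)
    (uniformProb_mono Ω₂ fun _ => And.left)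

end UniformEntropy

section UnionOfIndependentCopies

variable {α β : Type*} [DecidableEq α]

lemma uniformEntropy_inter_insert (Ω : Finset β) (f : β → Finset α) {T : Finset α} {i : α}
    (hi : i ∉ T) :
    uniformEntropy Ω (fun ω => f ω ∩ insert i T) = uniformEntropy Ω (fun ω => f ω ∩ T) +
      condEventEntropy Ω (fun ω => i ∉ f ω) (fun ω => f ω ∩ T) := by
  have hinj : (fun a : Finset α => (a.erase i, decide (i ∉ a))).Injective := by
    intro a b hab
    simp only [Prod.mk.injEq, decide_eq_decide, not_iff_not] at hab
    by_cases ha : i ∈ a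
    · rw [← insert_erase ha, hab.1, insert_erase (hab.2.1 ha)]
    · rw [← erase_eq_of_notMem ha, hab.1, erase_eq_of_notMem fun hb => ha (hab.2.2 hb)]
  rw [← uniformEntropy_comp_of_injective Ω (fun ω => f ω ∩ insert i T) hinj,
    ← uniformEntropy_pair_decide]
  congr! 3 with ω
  · rw [← inter_erase, erase_insert hi]
  · simp only [mem_inter, mem_insert_self, and_true]

lemma uniformEntropy_union_inter_insert_ge (Ω : Finset β) (f : β → Finset α) {T : Finset α}
    {i : α} (hi : i ∉ T) :
    8 / 5 * uniformProb Ω (fun ω => i ∉ f ω) *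
        (uniformEntropy Ω (fun ω => f ω ∩ insert i T) - uniformEntropy Ω (fun ω => f ω ∩ T)) ≤
      uniformEntropy (Ω ×ˢ Ω) (fun z => (f z.1 ∪ f z.2) ∩ insert i T) -
        uniformEntropy (Ω ×ˢ Ω) (fun z => (f z.1 ∪ f z.2) ∩ T) := by
  rw [uniformEntropy_inter_insert Ω f hi,
    uniformEntropy_inter_insert (Ω ×ˢ Ω) (fun z => f z.1 ∪ f z.2) hi, add_sub_cancel_left,
    add_sub_cancel_left]
  calc 8 / 5 * uniformProb Ω (fun ω => i ∉ f ω) *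
        condEventEntropy Ω (fun ω => i ∉ f ω) (fun ω => f ω ∩ T)
      ≤ condEventEntropy (Ω ×ˢ Ω) (fun z => i ∉ f z.1 ∧ i ∉ f z.2)
          (fun z => (f z.1 ∩ T, f z.2 ∩ T)) := by
        refine le_of_eq_of_le ?_ (condEventEntropy_product_ge Ω Ω (fun ω => i ∉ f ω)
          (fun ω => i ∉ f ω) (fun ω => f ω ∩ T) (fun ω => f ω ∩ T))
        ring
    _ ≤ condEventEntropy (Ω ×ˢ Ω) (fun z => i ∉ f z.1 ∧ i ∉ f z.2)
          (fun z => f z.1 ∩ T ∪ f z.2 ∩ T) :=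
        condEventEntropy_le_comp _ _ _ fun c : Finset α × Finset α => c.1 ∪ c.2
    _ = condEventEntropy (Ω ×ˢ Ω) (fun z => i ∉ f z.1 ∪ f z.2)
          (fun z => (f z.1 ∪ f z.2) ∩ T) := by
        simp only [union_inter_distrib_right, mem_union, not_or]

lemma uniformEntropy_union_inter_union_ge (Ω : Finset β) (f : β → Finset α) {T S : Finset α}
    (hTS : Disjoint T S) {r : ℝ} (hr : ∀ i ∈ S, r ≤ uniformProb Ω (fun ω => i ∉ f ω)) :
    8 / 5 * r *
        (uniformEntropy Ω (fun ω => f ω ∩ (T ∪ S)) - uniformEntropy Ω (fun ω => f ω ∩ T)) ≤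
      uniformEntropy (Ω ×ˢ Ω) (fun z => (f z.1 ∪ f z.2) ∩ (T ∪ S)) -
        uniformEntropy (Ω ×ˢ Ω) (fun z => (f z.1 ∪ f z.2) ∩ T) := by
  induction S using Finset.induction_on with
  | empty => simp
  | insert i S hiS ih =>
    obtain ⟨hiT, hTS⟩ := disjoint_insert_right.1 hTS
    have hi : i ∉ T ∪ S := by simp [hiT, hiS]
    have hstep := uniformEntropy_union_inter_insert_ge Ω f hi
    have hrest := ih hTS fun j hj => hr j (mem_insert_of_mem hj)
    have hmono : 0 ≤ uniformEntropy Ω (fun ω => f ω ∩ insert i (T ∪ S)) -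
        uniformEntropy Ω (fun ω => f ω ∩ (T ∪ S)) := by
      rw [uniformEntropy_inter_insert Ω f hi, add_sub_cancel_left]
      exact condEventEntropy_nonneg _ _ _
    have hri := mul_le_mul_of_nonneg_right (hr i (mem_insert_self i S)) hmono
    rw [union_insert]
    linarith

end UnionOfIndependentCopies

section UnionClosed

variable {α : Type*} [DecidableEq α] {F : Finset (Finset α)}

lemma uniformEntropy_union_le (hF : ∀ A ∈ F, ∀ B ∈ F, A ∪ B ∈ F) (hne : F.Nonempty)
    {γ : Finset α → ℝ} (hγ : ∀ A ∈ F, 0 < γ A) (hsum : ∑ A ∈ F, γ A ≤ #F) :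
    uniformEntropy (F ×ˢ F) (fun z => z.1 ∪ z.2) ≤
      Real.log #F - (∑ z ∈ F ×ˢ F, Real.log (γ (z.1 ∪ z.2))) / (#F : ℝ) ^ 2 := by
  have hn : (0 : ℝ) < #F := Nat.cast_pos.2 hne.card_pos
  have hunion : ∀ z ∈ F ×ˢ F, z.1 ∪ z.2 ∈ F := fun z hz =>
    hF _ (mem_product.1 hz).1 _ (mem_product.1 hz).2
  have hGibbs := uniformEntropy_le_neg_sum_log (Ω := F ×ˢ F) (g := fun z => z.1 ∪ z.2)
    (q := fun A => γ A / #F) (fun z hz => div_pos (hγ _ (hunion z hz)) hn) <|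
    calc ∑ A ∈ (F ×ˢ F).image (fun z => z.1 ∪ z.2), γ A / #F
        ≤ ∑ A ∈ F, γ A / #F :=
          sum_le_sum_of_subset_of_nonneg (image_subset_iff.2 hunion) fun A hA _ =>
            (div_pos (hγ A hA) hn).le
      _ ≤ 1 := by
          rw [← sum_div]
          exact div_le_one_of_le₀ hsum hn.le
  refine hGibbs.trans_eq ?_
  have hlog : ∀ z ∈ F ×ˢ F, Real.log (γ (z.1 ∪ z.2) / #F) =
      Real.log (γ (z.1 ∪ z.2)) - Real.log #F := fun z hz =>
    Real.log_div (hγ _ (hunion z hz)).ne' hn.ne'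
  rw [sum_congr rfl hlog, sum_sub_distrib, sum_const, card_product, nsmul_eq_mul, Nat.cast_mul]
  field_simp
  ring

/-- The entropy of `A ∪ B`, for independent uniform members `A` and `B` of `F`, is compared with
that of `A` coordinate by coordinate, beginning with the exceptional coordinate `x`. -/
lemma log_card_add_le (hF : ∀ A ∈ F, ∀ B ∈ F, A ∪ B ∈ F) (hne : F.Nonempty) {x : α} {r : ℝ}
    (hr : ∀ y ≠ x, r ≤ uniformProb F (y ∉ ·)) {γ : Finset α → ℝ} (hγ : ∀ A ∈ F, 0 < γ A)
    (hsum : ∑ A ∈ F, γ A ≤ #F) :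
    8 / 5 * r * Real.log #F +
        (∑ z ∈ F ×ˢ F, Real.log (γ (z.1 ∪ z.2))) / (#F : ℝ) ^ 2 ≤
      Real.log #F + 8 / 5 * ((r - uniformProb F (x ∉ ·)) *
        Real.binEntropy (uniformProb F (x ∉ ·))) := by
  have hinter : ∀ A ∈ F, A ∩ ({x} ∪ (groundSet F).erase x) = A := fun A hA =>
    inter_eq_left.2 fun y hy => by
      have : y ∈ groundSet F := mem_biUnion.2 ⟨A, hA, hy⟩
      by_cases hyx : y = x <;> simp [hyx, this]
  have hx := uniformEntropy_union_inter_insert_ge F id (notMem_empty x)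
  have hx_entropy := uniformEntropy_inter_insert F id (notMem_empty x)
  have hrest := uniformEntropy_union_inter_union_ge F id (T := {x}) (S := (groundSet F).erase x)
    (disjoint_singleton_left.2 (notMem_erase _ _)) fun i hi => hr i (ne_of_mem_erase hi)
  have hfull : uniformEntropy F (fun A => id A ∩ ({x} ∪ (groundSet F).erase x)) =
      Real.log #F := uniformEntropy_of_injOn fun A hA B hB hAB => by
    simpa only [id, hinter A hA, hinter B hB] using hAB
  have hunion := uniformEntropy_union_le hF hne hγ hsum
  have hcongr : uniformEntropy (F ×ˢ F)
      (fun z => (id z.1 ∪ id z.2) ∩ ({x} ∪ (groundSet F).erase x)) =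
      uniformEntropy (F ×ˢ F) (fun z => z.1 ∪ z.2) := uniformEntropy_congr fun z hz =>
    hinter _ (hF _ (mem_product.1 hz).1 _ (mem_product.1 hz).2)
  simp only [inter_empty, uniformEntropy_const, condEventEntropy_const, insert_empty, id, zero_add,
    sub_zero] at hx hx_entropy
  rw [hfull, hcongr] at hrest
  simp only [id, hx_entropy] at hx hrest
  linarith

lemma card_le_of_uniformProb_mem_le (hF : ∀ A ∈ F, ∀ B ∈ F, A ∪ B ∈ F) {x : α}
    (hx : ∀ y ≠ x, uniformProb F (y ∈ ·) ≤ 8 / 25) : #F ≤ 113 := by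
  by_contra! hcard
  have hne : F.Nonempty := card_pos.1 (by lia)
  have hentropy := log_card_add_le hF hne (x := x) (r := 17 / 25) (γ := 1)
    (fun y hy => by linarith [hx y hy, uniformProb_not hne (y ∈ ·)]) (by simp) (by simp)
  have hexceptional := sub_mul_binEntropy_le (17 / 25)
    (uniformProb_nonneg F (x ∉ ·)) (uniformProb_le_one F (x ∉ ·))
  simp only [Pi.one_apply, Real.log_one, sum_const_zero, zero_div] at hentropy
  linarith [lt_log_of_114_le hcard]

lemma sum_log_ite_mem_union_div (hne : F.Nonempty) (y : α) {a b : ℝ} :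
    (∑ z ∈ F ×ˢ F, Real.log (if y ∈ z.1 ∪ z.2 then a else b)) / (#F : ℝ) ^ 2 =
      Real.log a - uniformProb F (y ∉ ·) ^ 2 * (Real.log a - Real.log b) := by
  have _ : (#F : ℝ) ^ 2 ≠ 0 := pow_ne_zero 2 (Nat.cast_ne_zero.2 hne.card_ne_zero)
  have hterm : ∀ z ∈ F ×ˢ F, Real.log (if y ∈ z.1 ∪ z.2 then a else b) =
      Real.log a - (if y ∉ z.1 ∧ y ∉ z.2 then 1 else 0) * (Real.log a - Real.log b) := by
    intro z _
    simp only [← not_or, ← mem_union]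
    by_cases hy : y ∈ z.1 ∪ z.2 <;> simp [hy]
  rw [sum_congr rfl hterm, sum_sub_distrib, ← sum_mul, sum_boole,
    filter_product (fun A => y ∉ A) (fun A => y ∉ A), sum_const, card_product, card_product,
    nsmul_eq_mul, uniformProb]
  push_cast
  field_simp

/-- A union of two members contains `y` more often than a single member does, so in Gibbs'
inequality it pays to tilt the reference distribution towards the sets containing `y`. -/
lemma card_le_of_lt_uniformProb_mem (hF : ∀ A ∈ F, ∀ B ∈ F, A ∪ B ∈ F) {x y : α}
    (hx : ∀ z ≠ x, uniformProb F (z ∈ ·) ≤ 1 / 3) (hyx : y ≠ x)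
    (hy : 8 / 25 < uniformProb F (y ∈ ·)) : #F ≤ 113 := by
  by_contra! hcard
  have hne : F.Nonempty := card_pos.1 (by lia)
  have hnot := uniformProb_not hne (y ∈ ·)
  have hsum : ∑ A ∈ F, (if y ∈ A then 5 / 3 else 2 / 3 : ℝ) ≤ #F := by
    have hcount : uniformProb F (y ∈ ·) * #F = #{A ∈ F | y ∈ A} :=
      div_mul_cancel₀ _ (Nat.cast_ne_zero.2 hne.card_ne_zero)
    have hthird := mul_le_mul_of_nonneg_right (hx y hyx) (Nat.cast_nonneg (α := ℝ) #F)
    calc ∑ A ∈ F, (if y ∈ A then 5 / 3 else 2 / 3 : ℝ)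
        = ∑ A ∈ F, (2 / 3 + if y ∈ A then 1 else 0 : ℝ) :=
          sum_congr rfl fun A _ => by split_ifs <;> norm_num
      _ = #F * (2 / 3) + #{A ∈ F | y ∈ A} := by
          rw [sum_add_distrib, sum_const, nsmul_eq_mul, sum_boole]
      _ ≤ #F := by linarith
  have hentropy := log_card_add_le hF hne (x := x) (r := 2 / 3)
    (γ := fun A => if y ∈ A then 5 / 3 else 2 / 3)
    (fun z hz => by linarith [hx z hz, uniformProb_not hne (z ∈ ·)])
    (fun A _ => by split_ifs <;> norm_num) hsum
  have hexceptional := sub_mul_binEntropy_le (2 / 3)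
    (uniformProb_nonneg F (x ∉ ·)) (uniformProb_le_one F (x ∉ ·))
  rw [sum_log_ite_mem_union_div hne, Real.log_div (by norm_num) (by norm_num),
    Real.log_div (by norm_num) (by norm_num)] at hentropy
  have hsq : uniformProb F (y ∉ ·) ^ 2 ≤ (17 / 25) ^ 2 :=
    pow_le_pow_left₀ (uniformProb_nonneg _ _) (by linarith) 2
  have hgain := mul_le_mul_of_nonneg_right hsq
    (show 0 ≤ Real.log 5 - Real.log 2 by linarith [Real.log_two_lt_d9, Real.log_five_gt_d9])
  linarith [lt_log_of_114_le hcard, Real.log_two_lt_d9, Real.log_two_gt_d9, Real.log_three_lt_d9,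
    Real.log_five_gt_d9, Real.log_three_gt_d9]

lemma card_le_of_three_mul_setCount_le (hF : ∀ A ∈ F, ∀ B ∈ F, A ∪ B ∈ F) {x : α}
    (hx : ∀ y ≠ x, 3 * setCount F y ≤ #F) : #F ≤ 113 := by
  by_cases h : ∃ y ≠ x, 8 / 25 < uniformProb F (y ∈ ·)
  · obtain ⟨y, hyx, hy⟩ := h
    refine card_le_of_lt_uniformProb_mem hF (fun z hz => ?_) hyx hy
    have := Nat.cast_le (α := ℝ).2 (hx z hz)
    push_cast at this
    exact div_le_of_le_mul₀ (Nat.cast_nonneg _) (by norm_num) (by rw [setCount] at this; linarith)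
  · push Not at h
    exact card_le_of_uniformProb_mem_le hF h

end UnionClosed

section Traces

variable {α ι : Type*} [DecidableEq α] [Fintype ι]

/-- The trace of `A` on a family of points `e`, recorded as the set of indices `i` with
`e i ∈ A`. -/
def indexTrace (e : ι → α) (A : Finset α) : Finset ι := {i | e i ∈ A}

@[simp] lemma mem_indexTrace {e : ι → α} {A : Finset α} {i : ι} :
    i ∈ indexTrace e A ↔ e i ∈ A := by
  simp [indexTrace]

variable {F : Finset (Finset α)} {x w : α} {e : ι → α} {i j u v : ι} {K T : Finset ι}

lemma indexTrace_union [DecidableEq ι] (A B : Finset α) :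
    indexTrace e (A ∪ B) = indexTrace e A ∪ indexTrace e B := by
  ext; simp

/-- The values of `e` form a minimal transversal of the members of the union-closed family `F`
other than `∅` and `{x}`, and every element other than `x` belongs to at most a third of the
members. Minimality and injectivity of `e` are encoded by a private member for each index. -/
structure IsRareTransversal (F : Finset (Finset α)) (x : α) (e : ι → α) : Prop where
  union_mem : ∀ A ∈ F, ∀ B ∈ F, A ∪ B ∈ F
  count_le : ∀ y, y ≠ x → 3 * setCount F y ≤ #F
  ne_apex : ∀ i, e i ≠ x
  meets : ∀ A ∈ F, A ≠ ∅ → A ≠ {x} → (indexTrace e A).Nonempty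
  exists_private : ∀ i, ∃ A ∈ F, indexTrace e A = {i}

namespace IsRareTransversal

lemma exists_indexTrace_eq (h : IsRareTransversal F x e) (P : Finset α → Prop)
    (hP : ∀ A B, P A → P B → P (A ∪ B)) (hT : T.Nonempty)
    (hPT : ∀ i ∈ T, ∃ A ∈ F, indexTrace e A = {i} ∧ P A) :
    ∃ A ∈ F, indexTrace e A = T ∧ P A := by
  classical
  induction hT using Finset.Nonempty.cons_induction with
  | singleton i => exact hPT i (mem_singleton_self i)
  | cons i T hi _ ih =>
    obtain ⟨A, hA, hAT, hPA⟩ := hPT i (mem_cons_self _ _)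
    obtain ⟨B, hB, hBT, hPB⟩ := ih fun j hj => hPT j (mem_cons.2 (Or.inr hj))
    exact ⟨A ∪ B, h.union_mem A hA B hB, by rw [indexTrace_union, hAT, hBT, cons_eq_insert]; rfl,
      hP A B hPA hPB⟩

lemma exists_mem (h : IsRareTransversal F x e) (hT : T.Nonempty) :
    ∃ A ∈ F, indexTrace e A = T := by
  obtain ⟨A, hA, hAT, -⟩ := h.exists_indexTrace_eq (fun _ => True) (fun _ _ _ _ => trivial) hT
    fun i _ => by simpa using h.exists_private i
  exact ⟨A, hA, hAT⟩

lemma exists_mem_of_singleton (h : IsRareTransversal F x e)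
    (hj : ∃ A ∈ F, indexTrace e A = {j} ∧ w ∈ A) (hjT : j ∈ T) :
    ∃ A ∈ F, indexTrace e A = T ∧ w ∈ A := by
  classical
  obtain ⟨A, hA, hAj, hw⟩ := hj
  obtain ⟨B, hB, hBT⟩ := h.exists_mem ⟨j, hjT⟩
  refine ⟨A ∪ B, h.union_mem A hA B hB, ?_, mem_union_left _ hw⟩
  rw [indexTrace_union, hAj, hBT, union_eq_right.2 (singleton_subset_iff.2 hjT)]

end IsRareTransversal

variable [DecidableEq ι]

/-- The number of members of `F` with trace `T`. -/
def traceCount (F : Finset (Finset α)) (e : ι → α) (T : Finset ι) : ℕ :=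
  #{A ∈ F | indexTrace e A = T}

/-- `w` varies at `i` if it belongs to some, but not to all, of the members of `F` with trace
`{i}`. This is what produces several members of `F` with the same trace. -/
def VariesAt (F : Finset (Finset α)) (e : ι → α) (w : α) (i : ι) : Prop :=
  (∃ A ∈ F, indexTrace e A = {i} ∧ w ∈ A) ∧ ∃ A ∈ F, indexTrace e A = {i} ∧ w ∉ A

/-- The indices at which `w` is forced: those `j` such that every member of `F` with trace `{j}`
contains `w`. -/
def forcedIndices (F : Finset (Finset α)) (e : ι → α) (w : α) : Finset ι :=
  {j | ∀ A ∈ F, indexTrace e A = {j} → w ∈ A}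

lemma mem_indexTrace_update {A : Finset α} :
    j ∈ indexTrace (Function.update e u w) A ↔ if j = u then w ∈ A else j ∈ indexTrace e A := by
  rw [mem_indexTrace]
  split_ifs with hj
  · rw [hj, Function.update_self]
  · rw [Function.update_of_ne hj, mem_indexTrace]

lemma mem_forcedIndices : j ∈ forcedIndices F e w ↔ ∀ A ∈ F, indexTrace e A = {j} → w ∈ A := by
  simp [forcedIndices]

lemma notMem_forcedIndices :
    j ∉ forcedIndices F e w ↔ ∃ A ∈ F, indexTrace e A = {j} ∧ w ∉ A := by
  simp [forcedIndices]

lemma VariesAt.notMem_forcedIndices (h : VariesAt F e w i) : i ∉ forcedIndices F e w :=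
  _root_.notMem_forcedIndices.2 h.2

lemma sum_comp_indexTrace (F : Finset (Finset α)) (e : ι → α) (f : Finset ι → ℕ) :
    ∑ A ∈ F, f (indexTrace e A) = ∑ T, f T * traceCount F e T := by
  rw [← sum_fiberwise F (indexTrace e)]
  refine sum_congr rfl fun T _ => ?_
  rw [sum_congr rfl fun A hA => by rw [(mem_filter.1 hA).2], sum_const, smul_eq_mul, mul_comm,
    traceCount]

lemma sum_card_indexTrace_sdiff (F : Finset (Finset α)) (e : ι → α) (K : Finset ι) :
    ∑ A ∈ F, #(indexTrace e A \ K) = ∑ j ∈ Kᶜ, setCount F (e j) := by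
  simp only [setCount, card_filter]
  rw [sum_comm]
  refine sum_congr rfl fun A _ => ?_
  rw [← card_filter]
  congr 1
  ext j
  simp [and_comm]

lemma two_le_traceCount {A B : Finset α} (hA : A ∈ F) (hB : B ∈ F) (hAT : indexTrace e A = T)
    (hBT : indexTrace e B = T) (hwA : w ∈ A) (hwB : w ∉ B) : 2 ≤ traceCount F e T :=
  one_lt_card.2 ⟨A, mem_filter.2 ⟨hA, hAT⟩, B, mem_filter.2 ⟨hB, hBT⟩,
    ne_of_mem_of_not_mem' hwA hwB⟩

lemma sum_tsub_add_card_mul {β : Type*} (s : Finset β) (f : β → ℕ) (k : ℕ) :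
    ∑ b ∈ s, (f b - k) + #s * k = ∑ b ∈ s, f b + ∑ b ∈ s, (k - f b) := by
  rw [← smul_eq_mul, ← sum_const, ← sum_add_distrib, ← sum_add_distrib]
  exact sum_congr rfl fun b _ => by omega

lemma eq_empty_or_eq_pair_of_subset_pair {β : Type*} [DecidableEq β] {s : Finset β} {a b : β}
    (hs : s ⊆ {a, b}) (ha : s ≠ {a}) (hb : s ≠ {b}) : s = ∅ ∨ s = {a, b} := by
  rw [← coe_subset, coe_pair, Set.subset_pair_iff_eq] at hs
  norm_cast at hs
  tauto

lemma exists_mem_notMem_of_two_lt_card {β : Type*} {s : Finset (Finset β)} (hs : 2 < #s) (x : β) :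
    ∃ w, w ≠ x ∧ (∃ A ∈ s, w ∈ A) ∧ ∃ A ∈ s, w ∉ A := by
  classical
  by_contra! hall
  obtain ⟨A, hA⟩ := card_pos.1 (by omega : 0 < #s)
  have hsub : s ⊆ {A.erase x, insert x A} := by
    intro B hB
    have hBA : ∀ w, w ≠ x → (w ∈ B ↔ w ∈ A) := fun w hw =>
      ⟨fun hwB => hall w hw ⟨B, hB, hwB⟩ A hA, fun hwA => hall w hw ⟨A, hA, hwA⟩ B hB⟩
    rw [mem_insert, mem_singleton]
    by_cases hx : x ∈ B
    · right; ext w; by_cases hw : w = x <;> simp [hw, hx, hBA]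
    · left; ext w; by_cases hw : w = x <;> simp [hw, hx, hBA]
  exact absurd ((card_le_card hsub).trans card_le_two) (by omega)

lemma exists_variesAt (h : 3 ≤ traceCount F e {i}) (x : α) : ∃ w, w ≠ x ∧ VariesAt F e w i := by
  obtain ⟨w, hwx, ⟨A, hA, hwA⟩, B, hB, hwB⟩ := exists_mem_notMem_of_two_lt_card h x
  obtain ⟨hA, hAi⟩ := mem_filter.1 hA
  obtain ⟨hB, hBi⟩ := mem_filter.1 hB
  exact ⟨w, hwx, ⟨A, hA, hAi, hwA⟩, B, hB, hBi, hwB⟩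

namespace IsRareTransversal

lemma one_le_traceCount (h : IsRareTransversal F x e) (hT : T.Nonempty) :
    1 ≤ traceCount F e T := by
  obtain ⟨A, hA, hAT⟩ := h.exists_mem hT
  exact card_pos.2 ⟨A, mem_filter.2 ⟨hA, hAT⟩⟩

lemma traceCount_empty_le (h : IsRareTransversal F x e) : traceCount F e ∅ ≤ 2 := by
  refine (card_le_card (t := {∅, {x}}) fun A hA => ?_).trans card_le_two
  obtain ⟨hA, hAT⟩ := mem_filter.1 hA
  by_contra hne
  simp only [mem_insert, mem_singleton, not_or] at hne
  exact (h.meets A hA hne.1 hne.2).ne_empty hAT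

lemma exists_singleton_of_mem_forcedIndices (h : IsRareTransversal F x e)
    (hj : j ∈ forcedIndices F e w) : ∃ A ∈ F, indexTrace e A = {j} ∧ w ∈ A := by
  obtain ⟨A, hA, hAj⟩ := h.exists_private j
  exact ⟨A, hA, hAj, mem_forcedIndices.1 hj A hA hAj⟩

lemma exists_notMem (h : IsRareTransversal F x e) (hT : T.Nonempty)
    (hd : Disjoint T (forcedIndices F e w)) : ∃ A ∈ F, indexTrace e A = T ∧ w ∉ A :=
  h.exists_indexTrace_eq (fun A => w ∉ A) (fun A B hA hB => by simp [hA, hB]) hT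
    fun _ hi => notMem_forcedIndices.1 (disjoint_left.1 hd hi)

lemma two_le_traceCount_of_disjoint (h : IsRareTransversal F x e) (hv : VariesAt F e w i)
    (hiT : i ∈ T) (hd : Disjoint T (forcedIndices F e w)) : 2 ≤ traceCount F e T := by
  obtain ⟨A, hA, hAT, hwA⟩ := h.exists_mem_of_singleton hv.1 hiT
  obtain ⟨B, hB, hBT, hwB⟩ := h.exists_notMem ⟨i, hiT⟩ hd
  exact two_le_traceCount hA hB hAT hBT hwA hwB

lemma exists_ne_forall_two_le_traceCount [Nontrivial ι] (h : IsRareTransversal F x e)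
    (hv : VariesAt F e w i) (hQ : #(forcedIndices F e w) ≤ 1) :
    ∃ k, k ≠ i ∧ ∀ T : Finset ι, i ∈ T → k ∉ T → 2 ≤ traceCount F e T := by
  obtain ⟨k, hki, hk⟩ : ∃ k, k ≠ i ∧ forcedIndices F e w ⊆ {k} := by
    rcases (forcedIndices F e w).eq_empty_or_nonempty with hempty | ⟨k, hk⟩
    · obtain ⟨k, hki⟩ := exists_ne i
      exact ⟨k, hki, by simp [hempty]⟩
    · exact ⟨k, ne_of_mem_of_not_mem hk hv.notMem_forcedIndices,
        fun l hl => mem_singleton.2 (card_le_one.1 hQ l hl k hk)⟩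
  refine ⟨k, hki, fun T hiT hkT => h.two_le_traceCount_of_disjoint hv hiT ?_⟩
  exact disjoint_of_subset_right hk (disjoint_singleton_right.2 hkT)

lemma three_mul_sum_card_sdiff_le (h : IsRareTransversal F x e) (K : Finset ι) :
    3 * ∑ A ∈ F, #(indexTrace e A \ K) ≤ #Kᶜ * #F := by
  rw [sum_card_indexTrace_sdiff, mul_sum, ← smul_eq_mul, ← sum_const]
  exact sum_le_sum fun j _ => h.count_le _ (h.ne_apex j)

/-- A double count of the incidences between `F` and the points with index outside `K`, in which a
member of trace `T` is credited with its excess `#(T \ K) - k`. -/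
lemma three_mul_sum_tsub_mul_le (h : IsRareTransversal F x e) (K : Finset ι) (k : ℕ)
    (m : Finset ι → ℕ) (hm : ∀ T : Finset ι, T.Nonempty → m T ≤ traceCount F e T) :
    3 * ∑ T, (#(T \ K) - k) * m T + 3 * (#F * k)
      ≤ #Kᶜ * #F + 3 * ∑ T, (k - #(T \ K)) * traceCount F e T := by
  have hexcess : ∑ T, (#(T \ K) - k) * m T ≤ ∑ T, (#(T \ K) - k) * traceCount F e T := by
    refine sum_le_sum fun T _ => ?_
    rcases T.eq_empty_or_nonempty with rfl | hT
    · simp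
    · exact Nat.mul_le_mul_left _ (hm T hT)
  have hincidences := h.three_mul_sum_card_sdiff_le K
  have hsplit := sum_tsub_add_card_mul F (fun A => #(indexTrace e A \ K)) k
  rw [sum_comp_indexTrace F e fun T => #(T \ K) - k,
    sum_comp_indexTrace F e fun T => k - #(T \ K)] at hsplit
  omega

lemma three_mul_sum_sdiff_tsub_one_mul_le (h : IsRareTransversal F x e) (K : Finset ι)
    (m : Finset ι → ℕ) (hm : ∀ T : Finset ι, T.Nonempty → m T ≤ traceCount F e T) :
    3 * ∑ T, (#(T \ K) - 1) * m T + 3 * #F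
      ≤ #Kᶜ * #F + 3 * ∑ T ∈ K.powerset, traceCount F e T := by
  have hdeficit : ∑ T, (1 - #(T \ K)) * traceCount F e T
      = ∑ T ∈ K.powerset, traceCount F e T := by
    rw [← sum_subset (subset_univ K.powerset)]
    · refine sum_congr rfl fun T hT => ?_
      simp [sdiff_eq_empty_iff_subset.2 (mem_powerset.1 hT)]
    · intro T _ hT
      have hpos : 0 < #(T \ K) := card_pos.2 (sdiff_nonempty.2 (by simpa using hT))
      rw [Nat.sub_eq_zero_of_le hpos, zero_mul]
  simpa [hdeficit] using h.three_mul_sum_tsub_mul_le K 1 m hm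

lemma three_mul_sum_card_tsub_one_mul_le (h : IsRareTransversal F x e) (m : Finset ι → ℕ)
    (hm : ∀ T : Finset ι, T.Nonempty → m T ≤ traceCount F e T) :
    3 * ∑ T, (#T - 1) * m T + 3 * #F ≤ Fintype.card ι * #F + 6 := by
  have hcount := h.three_mul_sum_sdiff_tsub_one_mul_le ∅ m hm
  simp only [sdiff_empty, compl_empty, card_univ, powerset_empty, sum_singleton] at hcount
  linarith [h.traceCount_empty_le]

lemma three_mul_sum_sdiff_singleton_tsub_one_mul_le (h : IsRareTransversal F x e) (z : ι)
    (m : Finset ι → ℕ) (hm : ∀ T : Finset ι, T.Nonempty → m T ≤ traceCount F e T) :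
    3 * ∑ T, (#(T \ {z}) - 1) * m T + 3 * #F
      ≤ (Fintype.card ι - 1) * #F + 3 * traceCount F e {z} + 6 := by
  have hcount := h.three_mul_sum_sdiff_tsub_one_mul_le {z} m hm
  rw [card_compl, card_singleton, ← insert_empty_eq z, sum_powerset_insert (notMem_empty z),
    powerset_empty, sum_singleton, sum_singleton, insert_empty_eq] at hcount
  linarith [h.traceCount_empty_le]

lemma three_mul_sum_card_sdiff_add_le (h : IsRareTransversal F x e) (hwx : w ≠ x) (K : Finset ι) :
    3 * ∑ A ∈ F, (#(indexTrace e A \ K) + if w ∈ A then 1 else 0) ≤ (#Kᶜ + 1) * #F := by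
  rw [sum_add_distrib, ← card_filter, ← setCount]
  linarith [h.three_mul_sum_card_sdiff_le K, h.count_le w hwx]

lemma sum_tsub_one_le_sum_tsub_one (h : IsRareTransversal F x e) (K : Finset ι) {L : Finset ι}
    (hL : ∀ j ∈ L, ∃ A ∈ F, indexTrace e A = {j} ∧ w ∈ A) :
    ∑ T : Finset ι, (#(T \ K) + (if (T ∩ L).Nonempty then 1 else 0) - 1)
      ≤ ∑ A ∈ F, (#(indexTrace e A \ K) + (if w ∈ A then 1 else 0) - 1) := by
  rw [← sum_fiberwise F (indexTrace e)]
  refine sum_le_sum fun T _ => ?_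
  rcases T.eq_empty_or_nonempty with rfl | hT
  · simp
  obtain ⟨A, hA, hAT, hw⟩ : ∃ A ∈ F, indexTrace e A = T ∧ ((T ∩ L).Nonempty → w ∈ A) := by
    by_cases hTL : (T ∩ L).Nonempty
    · obtain ⟨j, hj⟩ := hTL
      obtain ⟨hjT, hjL⟩ := mem_inter.1 hj
      obtain ⟨A, hA, hAT, hw⟩ := h.exists_mem_of_singleton (hL j hjL) hjT
      exact ⟨A, hA, hAT, fun _ => hw⟩
    · obtain ⟨A, hA, hAT⟩ := h.exists_mem hT
      exact ⟨A, hA, hAT, fun hTL' => absurd hTL' hTL⟩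
  refine le_trans ?_ (single_le_sum
    (f := fun A => #(indexTrace e A \ K) + (if w ∈ A then 1 else 0) - 1)
    (fun _ _ => Nat.zero_le _) (mem_filter.2 ⟨hA, hAT⟩))
  simp only [hAT]
  grind

lemma sum_one_tsub_le (h : IsRareTransversal F x e)
    (hu : u ∈ forcedIndices F e w) (hv : v ∈ forcedIndices F e w) :
    ∑ A ∈ F, (1 - (#(indexTrace e A \ {u, v}) + if w ∈ A then 1 else 0))
      ≤ 2 + #{A ∈ F | indexTrace e A = {u, v} ∧ w ∉ A} := by
  calc ∑ A ∈ F, (1 - (#(indexTrace e A \ {u, v}) + if w ∈ A then 1 else 0))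
      ≤ ∑ A ∈ F, ((if indexTrace e A = ∅ then 1 else 0)
          + if indexTrace e A = {u, v} ∧ w ∉ A then 1 else 0) := by
        refine sum_le_sum fun A hA => ?_
        by_cases hzero : indexTrace e A ⊆ {u, v} ∧ w ∉ A
        · obtain ⟨hsub, hwA⟩ := hzero
          rcases eq_empty_or_eq_pair_of_subset_pair hsub
            (fun hAu => hwA (mem_forcedIndices.1 hu A hA hAu))
            (fun hAv => hwA (mem_forcedIndices.1 hv A hA hAv)) with hAT | hAT <;>
          simp [hAT, hwA]
        · rw [not_and_or, not_not, ← sdiff_nonempty, ← card_pos] at hzero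
          rcases hzero with hpos | hwA
          · omega
          · simp [hwA]
    _ ≤ 2 + #{A ∈ F | indexTrace e A = {u, v} ∧ w ∉ A} := by
        rw [sum_add_distrib, ← card_filter, ← card_filter]
        exact Nat.add_le_add_right h.traceCount_empty_le _

/-- A double count of the incidences between `F` and `w` together with the points of index outside
`{u, v}`: if `w` is forced at `u` and `v`, the only members without such an incidence are the few
with empty trace and those with trace `{u, v}` that avoid `w`, so there are many of the latter. -/
lemma le_card_indexTrace_eq_pair (h : IsRareTransversal F x e) (hwx : w ≠ x)
    (hi : VariesAt F e w i) (hu : u ∈ forcedIndices F e w) (hv : v ∈ forcedIndices F e w) :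
    3 * ∑ T : Finset ι, (#(T \ {u, v}) + (if (T ∩ {u, v, i}).Nonempty then 1 else 0) - 1)
        + 3 * #F
      ≤ (#({u, v}ᶜ : Finset ι) + 1) * #F + 6
        + 3 * #{A ∈ F | indexTrace e A = {u, v} ∧ w ∉ A} := by
  have hincidences := h.three_mul_sum_card_sdiff_add_le hwx {u, v}
  have hexcess := h.sum_tsub_one_le_sum_tsub_one (w := w) {u, v} (L := {u, v, i}) (by
    simpa using ⟨h.exists_singleton_of_mem_forcedIndices hu,
      h.exists_singleton_of_mem_forcedIndices hv, hi.1⟩)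
  have hdeficit := h.sum_one_tsub_le hu hv
  have hsplit := sum_tsub_add_card_mul F
    (fun A => #(indexTrace e A \ {u, v}) + if w ∈ A then 1 else 0) 1
  linarith

lemma card_indexTrace_eq_pair_lt_traceCount (h : IsRareTransversal F x e)
    (hu : u ∈ forcedIndices F e w) :
    #{A ∈ F | indexTrace e A = {u, v} ∧ w ∉ A} < traceCount F e {u, v} := by
  obtain ⟨A, hA, hAT, hw⟩ := h.exists_mem_of_singleton
    (h.exists_singleton_of_mem_forcedIndices hu) (mem_insert_self u {v})
  rw [traceCount, ← filter_filter]
  exact card_lt_card (filter_ssubset.2 ⟨A, mem_filter.2 ⟨hA, hAT⟩, by simpa using hw⟩)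

lemma two_le_traceCount_of_inter_forcedIndices (h : IsRareTransversal F x e)
    (hT : T ∩ forcedIndices F e w = {u, v})
    (hpair : 0 < #{A ∈ F | indexTrace e A = {u, v} ∧ w ∉ A}) : 2 ≤ traceCount F e T := by
  obtain ⟨huT, hu⟩ : u ∈ T ∧ u ∈ forcedIndices F e w := by simp [← mem_inter, hT]
  obtain ⟨A, hA, hAT, hwA⟩ :=
    h.exists_mem_of_singleton (h.exists_singleton_of_mem_forcedIndices hu) huT
  obtain ⟨B, hB⟩ := card_pos.1 hpair
  obtain ⟨hB, hBT, hwB⟩ := mem_filter.1 hB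
  have hunion : {u, v} ∪ T \ forcedIndices F e w = T := by
    rw [← hT, union_comm, sdiff_union_inter]
  rcases (T \ forcedIndices F e w).eq_empty_or_nonempty with hempty | hne
  · rw [hempty, union_empty] at hunion
    exact two_le_traceCount hA hB hAT (hBT.trans hunion) hwA hwB
  · obtain ⟨C, hC, hCT, hwC⟩ := h.exists_notMem hne sdiff_disjoint
    exact two_le_traceCount hA (h.union_mem B hB C hC) hAT
      (by rw [indexTrace_union, hBT, hCT, hunion]) hwA (by simp [hwB, hwC])

lemma update_of_forcedIndices_eq (h : IsRareTransversal F x e) (hwx : w ≠ x)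
    (hu : forcedIndices F e w = {u}) :
    IsRareTransversal F x (Function.update e u w) := by
  have huf : u ∈ forcedIndices F e w := by simp [hu]
  refine ⟨h.union_mem, h.count_le, fun j => ?_, fun A hA h0 hx => ?_, fun j => ?_⟩
  · rcases eq_or_ne j u with rfl | hj
    · rwa [Function.update_self]
    · rw [Function.update_of_ne hj]
      exact h.ne_apex j
  · by_cases hAu : indexTrace e A = {u}
    · exact ⟨u, by simpa [mem_indexTrace_update] using mem_forcedIndices.1 huf A hA hAu⟩
    · obtain ⟨j, hj, hju⟩ : ∃ j ∈ indexTrace e A, j ≠ u := by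
        by_contra! hall
        exact hAu (eq_singleton_iff_nonempty_unique_mem.2 ⟨h.meets A hA h0 hx, hall⟩)
      exact ⟨j, by rwa [mem_indexTrace_update, if_neg hju]⟩
  · rcases eq_or_ne j u with rfl | hj
    · obtain ⟨A, hA, hAj, hw⟩ := h.exists_singleton_of_mem_forcedIndices huf
      refine ⟨A, hA, ?_⟩
      ext l
      rw [mem_indexTrace_update, hAj, mem_singleton]
      grind
    · obtain ⟨A, hA, hAj, hw⟩ := notMem_forcedIndices.1
        (show j ∉ forcedIndices F e w by simpa [hu] using hj)
      refine ⟨A, hA, ?_⟩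
      ext l
      rw [mem_indexTrace_update, hAj, mem_singleton]
      grind

lemma two_le_traceCount_update (h : IsRareTransversal F x e) (hi : VariesAt F e w i)
    (hu : u ∈ forcedIndices F e w) (huT : u ∈ T) (hiT : i ∈ T) :
    2 ≤ traceCount F (Function.update e u w) T := by
  have hiu : i ≠ u := (ne_of_mem_of_not_mem hu hi.notMem_forcedIndices).symm
  have htrace : ∀ A, w ∈ A → (indexTrace e A).erase u = T.erase u →
      indexTrace (Function.update e u w) A = T := by
    intro A hw hAT
    ext l
    have hl := Finset.ext_iff.1 hAT l
    rw [mem_indexTrace_update]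
    grind
  obtain ⟨A, hA, hAT, hwA⟩ :=
    h.exists_mem_of_singleton (h.exists_singleton_of_mem_forcedIndices hu) huT
  obtain ⟨B, hB, hBT, hwB⟩ := h.exists_mem_of_singleton hi.1 (mem_erase.2 ⟨hiu, hiT⟩)
  exact two_le_traceCount (w := e u) hA hB (htrace A hwA (by rw [hAT]))
    (htrace B hwB (by rw [hBT, erase_idem])) (by rwa [← mem_indexTrace, hAT])
    (by rw [← mem_indexTrace, hBT]; exact notMem_erase u T)

end IsRareTransversal

end Traces

section FixedPointFreeMaps

variable {ι : Type*} [DecidableEq ι] {g : ι → ι} {T T' : Finset ι} {i i' j k : ι}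

/-- Take `j` on a cycle of `g`: a closed set containing `g j` contains the whole cycle. -/
lemma exists_forall_mem_iff_apply_mem [Finite ι] [Nonempty ι] (g : ι → ι) :
    ∃ j, ∀ T : Finset ι, T.image g ⊆ T → (j ∈ T ↔ g j ∈ T) := by
  obtain ⟨m, n, hmn, heq⟩ :=
    Finite.exists_ne_map_eq_of_infinite fun n : ℕ => g^[n] (Classical.arbitrary ι)
  wlog hlt : m < n generalizing m n
  · exact this n m hmn.symm heq.symm (by omega)
  set j := g^[m] (Classical.arbitrary ι)
  have hperiod : g^[n - m - 1] (g j) = j := by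
    rw [← Function.iterate_succ_apply, Nat.succ_eq_add_one, Nat.sub_add_cancel (by omega),
      ← Function.iterate_add_apply, Nat.sub_add_cancel hlt.le]
    exact heq.symm
  refine ⟨j, fun T hT => ⟨fun hj => hT (mem_image_of_mem g hj), fun hgj => ?_⟩⟩
  have horbit : ∀ k, g^[k] (g j) ∈ T := fun k => by
    induction k with
    | zero => exact hgj
    | succ k ih => rw [Function.iterate_succ_apply']; exact hT (mem_image_of_mem g ih)
  exact hperiod ▸ horbit (n - m - 1)

lemma eq_of_erase_apply_eq (hg : ∀ i, g i ≠ i) (hT : T.image g ⊆ T) (hT' : T'.image g ⊆ T')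
    (hi : i ∈ T) (hi' : i' ∈ T') (heq : T.erase (g i) = T'.erase (g i')) : T = T' := by
  have hgi : g i ∈ T := hT (mem_image_of_mem g hi)
  have hgi' : g i' ∈ T' := hT' (mem_image_of_mem g hi')
  rcases eq_or_ne (g i) (g i') with h | hne
  · rw [← insert_erase hgi, heq, h, insert_erase hgi']
  · have hmem : i ∈ T'.erase (g i') := heq ▸ mem_erase.2 ⟨(hg i).symm, hi⟩
    have hgmem : g i ∈ T'.erase (g i') :=
      mem_erase.2 ⟨hne, hT' (mem_image_of_mem g (mem_of_mem_erase hmem))⟩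
    exact absurd (heq ▸ hgmem) (notMem_erase _ _)

lemma not_image_subset_insert_insert_erase (hg : ∀ i, g i ≠ i) (hT : T.image g ⊆ T) (hi : i ∈ T)
    (hj : j ∉ T) (hk : k ∉ T) :
    ¬ (insert j (insert k (T.erase (g i)))).image g ⊆ insert j (insert k (T.erase (g i))) := by
  intro hclosed
  have hgi : g i ∈ T := hT (mem_image_of_mem g hi)
  have hmem := hclosed (mem_image_of_mem g (a := i) (by simp [(hg i).symm, hi]))
  simp only [mem_insert, notMem_erase, or_false] at hmem
  exact hmem.elim (fun h => hj (h ▸ hgi)) (fun h => hk (h ▸ hgi))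

variable [Fintype ι]

/-- A nonempty closed set `T` that misses `j` and `k` is sent injectively to the larger set
`(T ∪ {j, k}) \ {g i}` with `i ∈ T`, which is not closed. -/
lemma sum_closed_notMem_le (hg : ∀ i, g i ≠ i) (hjk : j ≠ k)
    (hmem : ∀ T : Finset ι, T.image g ⊆ T → (j ∈ T ↔ k ∈ T)) :
    ∑ T : Finset ι with T.Nonempty ∧ T.image g ⊆ T ∧ j ∉ T, (#T - 1)
      ≤ ∑ T : Finset ι with (j ∈ T ∧ k ∈ T) ∧ ¬ T.image g ⊆ T, (#T - 1) := by
  choose p hp using fun T : {T : Finset ι // T.Nonempty} => T.2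
  let φ : Finset ι → Finset ι := fun T =>
    if h : T.Nonempty then insert j (insert k (T.erase (g (p ⟨T, h⟩)))) else ∅
  have hφ : ∀ T, T.Nonempty ∧ T.image g ⊆ T ∧ j ∉ T →
      k ∉ T ∧ ∃ i ∈ T, φ T = insert j (insert k (T.erase (g i))) := fun T ⟨hne, hT, hj⟩ =>
    ⟨fun hk => hj ((hmem T hT).2 hk), p ⟨T, hne⟩, hp ⟨T, hne⟩, dif_pos hne⟩
  have hcard : ∀ T, T.Nonempty ∧ T.image g ⊆ T ∧ j ∉ T → #T ≤ #(φ T) := fun T hT => by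
    obtain ⟨hk, i, hi, hφT⟩ := hφ T hT
    rw [hφT, card_insert_of_notMem (by simp [hjk, hT.2.2]), card_insert_of_notMem (by simp [hk]),
      card_erase_of_mem (hT.2.1 (mem_image_of_mem g hi))]
    omega
  refine (sum_le_sum fun T hT => Nat.sub_le_sub_right (hcard T (mem_filter.1 hT).2) 1).trans ?_
  rw [← sum_image (f := fun T => #T - 1)]
  · refine sum_le_sum_of_subset (image_subset_iff.2 fun T hT => mem_filter.2 ⟨mem_univ _, ?_⟩)
    have hT := (mem_filter.1 hT).2
    obtain ⟨hk, i, hi, hφT⟩ := hφ T hT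
    rw [hφT]
    exact ⟨by simp, not_image_subset_insert_insert_erase hg hT.2.1 hi hT.2.2 hk⟩
  · intro T hT T' hT' heq
    have hT := (mem_filter.1 hT).2
    have hT' := (mem_filter.1 hT').2
    obtain ⟨hk, i, hi, hφT⟩ := hφ T hT
    obtain ⟨hk', i', hi', hφT'⟩ := hφ T' hT'
    have herase := congrArg (fun U => (U.erase j).erase k) (hφT.symm.trans (heq.trans hφT'))
    refine eq_of_erase_apply_eq hg hT.2.1 hT'.2.1 hi hi' ?_
    simpa [hT.2.2, hT'.2.2, hk, hk', hjk] using herase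

lemma sum_closed_le (hg : ∀ i, g i ≠ i) (hjk : j ≠ k)
    (hmem : ∀ T : Finset ι, T.image g ⊆ T → (j ∈ T ↔ k ∈ T)) :
    ∑ T : Finset ι with T.image g ⊆ T, (#T - 1)
      ≤ ∑ T : Finset ι with j ∈ T ∧ k ∈ T, (#T - 1) := by
  rw [← sum_filter_not_add_sum_filter (filter _ _) (fun T => j ∈ T),
    ← sum_filter_not_add_sum_filter (filter (fun T => j ∈ T ∧ k ∈ T) _)
      (fun T => T.image g ⊆ T), filter_filter, filter_filter, filter_filter, filter_filter]
  refine add_le_add (le_trans (sum_le_sum_of_ne_zero fun T hT hne => ?_)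
    (sum_closed_notMem_le hg hjk hmem)) (sum_le_sum_of_subset fun T hT => ?_)
  · exact mem_filter.2 ⟨mem_univ T, card_pos.1 (by omega), (mem_filter.1 hT).2⟩
  · obtain ⟨hclosed, hj⟩ := (mem_filter.1 hT).2
    exact mem_filter.2 ⟨mem_univ T, ⟨hj, (hmem T hclosed).1 hj⟩, hclosed⟩

end FixedPointFreeMaps

section FiniteSums

lemma sum_mem_mem_five : ∀ j k : Fin 5, j ≠ k →
    ∑ T : Finset (Fin 5) with j ∈ T ∧ k ∈ T, (#T - 1) = 20 := by
  decide +kernel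

lemma sum_closed_five (g : Fin 5 → Fin 5) (hg : ∀ j, g j ≠ j) :
    78 ≤ ∑ T : Finset (Fin 5), (#T - 1) * if T.image g ⊆ T then 1 else 2 := by
  obtain ⟨j, hj⟩ := exists_forall_mem_iff_apply_mem g
  have hclosed := sum_closed_le hg (hg j).symm hj
  rw [sum_mem_mem_five j (g j) (hg j).symm, sum_filter] at hclosed
  have htotal : ∑ T : Finset (Fin 5), (#T - 1) * 2 = 98 := by decide +kernel
  have hsplit : ∑ T : Finset (Fin 5), (#T - 1) * 2
      = ∑ T : Finset (Fin 5), (#T - 1) * (if T.image g ⊆ T then 1 else 2)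
        + ∑ T : Finset (Fin 5), if T.image g ⊆ T then #T - 1 else 0 := by
    rw [← sum_add_distrib]
    exact sum_congr rfl fun T _ => by split_ifs <;> omega
  omega

set_option maxRecDepth 100000 in
lemma sum_exchange_four : ∀ j k u i : Fin 4, j ≠ k → u ≠ i →
    29 ≤ ∑ T : Finset (Fin 4), (#T - 1) *
      if (u ∈ T ∧ i ∈ T) ∨ ¬ (j ∈ T ↔ k ∈ T) then 2 else 1 := by
  decide +kernel

lemma sum_forced_pair_four : ∀ i u v : Fin 4, i ≠ u → i ≠ v → u ≠ v →
    ∑ T : Finset (Fin 4), (#(T \ {u, v}) + (if (T ∩ {u, v, i}).Nonempty then 1 else 0) - 1)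
      = 15 := by
  decide +kernel

lemma sum_pair_four : ∀ u v : Fin 4, u ≠ v →
    ∑ T : Finset (Fin 4), (#T - 1) * (if T = {u, v} then 14 else 1) = 30 := by
  decide +kernel

lemma sum_forced_pair_five : ∀ i u v : Fin 5, i ≠ u → i ≠ v → u ≠ v →
    ∑ T : Finset (Fin 5), (#(T \ {u, v}) + (if (T ∩ {u, v, i}).Nonempty then 1 else 0) - 1)
      = 45 := by
  decide +kernel

set_option maxRecDepth 100000 in
lemma sum_forced_five : ∀ (i : Fin 5) (Q : Finset (Fin 5)), i ∉ Q → 2 ≤ #Q →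
    78 ≤ ∑ T : Finset (Fin 5), (#T - 1) *
      if #T = 2 ∧ T ⊆ Q then 7 else if #(T ∩ Q) = 2 then 2
        else if i ∈ T ∧ T ∩ Q = ∅ then 2 else 1 := by
  decide +kernel

lemma sum_sdiff_five : ∀ z y k : Fin 5, y ≠ z → k ≠ y →
    42 ≤ ∑ T : Finset (Fin 5), (#(T \ {z}) - 1) * if y ∈ T ∧ k ∉ T then 2 else 1 := by
  decide +kernel

end FiniteSums

namespace IsRareTransversal

variable {α : Type*} [DecidableEq α] {F : Finset (Finset α)} {x w : α}

lemma exists_map_forall_two_le_traceCount {ι : Type*} [Fintype ι] [DecidableEq ι] [Nontrivial ι]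
    {e : ι → α} (h : IsRareTransversal F x e) (hcount : ∀ j, 3 ≤ traceCount F e {j})
    (hforced : ∀ (w : α) (j : ι), w ≠ x → VariesAt F e w j → #(forcedIndices F e w) ≤ 1) :
    ∃ g : ι → ι, (∀ j, g j ≠ j) ∧
      ∀ T : Finset ι, ¬ T.image g ⊆ T → 2 ≤ traceCount F e T := by
  have hexists : ∀ j, ∃ k, k ≠ j ∧ ∀ T : Finset ι, j ∈ T → k ∉ T → 2 ≤ traceCount F e T := by
    intro j
    obtain ⟨w, hwx, hw⟩ := exists_variesAt (hcount j) x
    exact h.exists_ne_forall_two_le_traceCount hw (hforced w j hwx hw)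
  choose g hg hgT using hexists
  refine ⟨g, hg, fun T hT => ?_⟩
  obtain ⟨j, hj, hgj⟩ : ∃ j ∈ T, g j ∉ T := by simpa [image_subset_iff] using hT
  exact hgT j T hj hgj

section Four

variable {e : Fin 4 → α}

lemma three_le_traceCount_four (h : IsRareTransversal F x e) (z : Fin 4) :
    3 ≤ traceCount F e {z} := by
  by_contra! hz
  have hweight : ∀ z : Fin 4, ∑ T : Finset (Fin 4), (#(T \ {z}) - 1) * 1 = 10 := by decide +kernel
  have hcount := h.three_mul_sum_sdiff_singleton_tsub_one_mul_le z (fun _ => 1)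
    fun T hT => h.one_le_traceCount hT
  rw [hweight, Fintype.card_fin] at hcount
  omega

lemma card_forcedIndices_le_one_of_four (h : IsRareTransversal F x e) (hF : #F ≤ 80)
    (hwx : w ≠ x) {i : Fin 4} (hi : VariesAt F e w i) : #(forcedIndices F e w) ≤ 1 := by
  by_contra! hforced
  obtain ⟨u, hu, v, hv, huv⟩ := one_lt_card.1 hforced
  have hiu : i ≠ u := (ne_of_mem_of_not_mem hu hi.notMem_forcedIndices).symm
  have hiv : i ≠ v := (ne_of_mem_of_not_mem hv hi.notMem_forcedIndices).symm
  have hpair := h.le_card_indexTrace_eq_pair hwx hi hu hv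
  rw [sum_forced_pair_four i u v hiu hiv huv, card_compl, card_pair huv, Fintype.card_fin] at hpair
  have hlt := h.card_indexTrace_eq_pair_lt_traceCount (v := v) hu
  have hcount := h.three_mul_sum_card_tsub_one_mul_le (fun T => if T = {u, v} then 14 else 1)
    fun T hT => by
      split_ifs with hTuv
      · rw [hTuv]; omega
      · exact h.one_le_traceCount hT
  rw [sum_pair_four u v huv, Fintype.card_fin] at hcount
  omega

lemma card_ge_of_four_of_forcedIndices_eq_empty (h : IsRareTransversal F x e) {i : Fin 4}
    (hi : VariesAt F e w i) (hforced : forcedIndices F e w = ∅) : 81 ≤ #F := by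
  have hweight : ∀ i : Fin 4, ∑ T : Finset (Fin 4), (#T - 1) * (if i ∈ T then 2 else 1) = 29 := by
    decide +kernel
  have hcount := h.three_mul_sum_card_tsub_one_mul_le (fun T => if i ∈ T then 2 else 1)
    fun T hT => by
      split_ifs with hiT
      · exact h.two_le_traceCount_of_disjoint hi hiT (by simp [hforced])
      · exact h.one_le_traceCount hT
  rw [hweight, Fintype.card_fin] at hcount
  omega

/-- Here `e u` is exchanged for `w`: the traces on the new transversal that contain `u` and `i` are
repeated, and so are those that separate the two points of a further pair `j ≠ g j`. -/
lemma card_ge_of_four_of_forcedIndices_eq_singleton (h : IsRareTransversal F x e) (hF : #F ≤ 80)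
    (hwx : w ≠ x) {i u : Fin 4} (hi : VariesAt F e w i) (hforced : forcedIndices F e w = {u}) :
    81 ≤ #F := by
  have hu : u ∈ forcedIndices F e w := by simp [hforced]
  have h' := h.update_of_forcedIndices_eq hwx hforced
  obtain ⟨g, hg, hgT⟩ := h'.exists_map_forall_two_le_traceCount h'.three_le_traceCount_four
    fun w' j hw' hj => h'.card_forcedIndices_le_one_of_four hF hw' hj
  obtain ⟨j, hj⟩ := exists_forall_mem_iff_apply_mem g
  have hcount := h'.three_mul_sum_card_tsub_one_mul_le
    (fun T => if (u ∈ T ∧ i ∈ T) ∨ ¬ (j ∈ T ↔ g j ∈ T) then 2 else 1) fun T hT => by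
      split_ifs with hc
      · rcases hc with ⟨huT, hiT⟩ | hjT
        · exact h.two_le_traceCount_update hi hu huT hiT
        · exact hgT T (mt (hj T) hjT)
      · exact h'.one_le_traceCount hT
  have hweight := sum_exchange_four j (g j) u i (hg j).symm
    (ne_of_mem_of_not_mem hu hi.notMem_forcedIndices)
  rw [Fintype.card_fin] at hcount
  omega

lemma card_ge_of_four (h : IsRareTransversal F x e) : 81 ≤ #F := by
  by_contra! hlt
  have hF : #F ≤ 80 := by omega
  obtain ⟨w, hwx, hw⟩ := exists_variesAt (h.three_le_traceCount_four 0) x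
  rcases (forcedIndices F e w).eq_empty_or_nonempty with hempty | hne
  · exact hlt.not_ge (h.card_ge_of_four_of_forcedIndices_eq_empty hw hempty)
  · obtain ⟨u, hu⟩ := card_eq_one.1
      ((h.card_forcedIndices_le_one_of_four hF hwx hw).antisymm (card_pos.2 hne))
    exact hlt.not_ge (h.card_ge_of_four_of_forcedIndices_eq_singleton hF hwx hw hu)

end Four

section Five

variable {e : Fin 5 → α}

lemma six_le_card_indexTrace_eq_pair_five (h : IsRareTransversal F x e) (hF : #F ≤ 113)
    (hwx : w ≠ x) {i u v : Fin 5} (hi : VariesAt F e w i) (hu : u ∈ forcedIndices F e w)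
    (hv : v ∈ forcedIndices F e w) (huv : u ≠ v) :
    6 ≤ #{A ∈ F | indexTrace e A = {u, v} ∧ w ∉ A} := by
  have hiu : i ≠ u := (ne_of_mem_of_not_mem hu hi.notMem_forcedIndices).symm
  have hiv : i ≠ v := (ne_of_mem_of_not_mem hv hi.notMem_forcedIndices).symm
  have hpair := h.le_card_indexTrace_eq_pair hwx hi hu hv
  rw [sum_forced_pair_five i u v hiu hiv huv, card_compl, card_pair huv, Fintype.card_fin] at hpair
  omega

lemma card_forcedIndices_le_one_of_five (h : IsRareTransversal F x e) (hF : #F ≤ 113)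
    (hwx : w ≠ x) {i : Fin 5} (hi : VariesAt F e w i) : #(forcedIndices F e w) ≤ 1 := by
  by_contra! hforced
  have hcount := h.three_mul_sum_card_tsub_one_mul_le
    (fun T => if #T = 2 ∧ T ⊆ forcedIndices F e w then 7
      else if #(T ∩ forcedIndices F e w) = 2 then 2
        else if i ∈ T ∧ T ∩ forcedIndices F e w = ∅ then 2 else 1) fun T hT => by
    split_ifs with hpair hinter hiT
    · obtain ⟨u, v, huv, rfl⟩ := card_eq_two.1 hpair.1
      have hu := hpair.2 (mem_insert_self u {v})
      have hv := hpair.2 (mem_insert_of_mem (mem_singleton_self v))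
      have := h.six_le_card_indexTrace_eq_pair_five hF hwx hi hu hv huv
      have := h.card_indexTrace_eq_pair_lt_traceCount (v := v) hu
      omega
    · obtain ⟨u, v, huv, hTuv⟩ := card_eq_two.1 hinter
      have hsub : {u, v} ⊆ forcedIndices F e w := hTuv ▸ inter_subset_right
      rw [insert_subset_iff, singleton_subset_iff] at hsub
      have := h.six_le_card_indexTrace_eq_pair_five hF hwx hi hsub.1 hsub.2 huv
      exact h.two_le_traceCount_of_inter_forcedIndices hTuv (by omega)
    · exact h.two_le_traceCount_of_disjoint hi hiT.1 (disjoint_iff_inter_eq_empty.2 hiT.2)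
    · exact h.one_le_traceCount hT
  have hweight := sum_forced_five i (forcedIndices F e w) hi.notMem_forcedIndices hforced
  rw [Fintype.card_fin] at hcount
  omega

lemma exists_three_le_traceCount_five (h : IsRareTransversal F x e) (hF : #F ≤ 113) :
    ∃ y, 3 ≤ traceCount F e {y} := by
  by_contra! hall
  have hcount := h.three_mul_sum_tsub_mul_le ∅ 2 (fun _ => 1) fun T hT => h.one_le_traceCount hT
  have hexcess : ∑ T : Finset (Fin 5), (#(T \ ∅) - 2) * 1 = 23 := by decide +kernel
  have hdeficit : ∑ T : Finset (Fin 5), (2 - #(T \ ∅)) * traceCount F e T ≤ 14 :=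
    calc ∑ T : Finset (Fin 5), (2 - #(T \ ∅)) * traceCount F e T
        ≤ ∑ T : Finset (Fin 5), (2 - #T) * 2 := by
          refine sum_le_sum fun T _ => ?_
          rw [sdiff_empty]
          rcases le_or_gt 2 #T with hT | hT
          · rw [Nat.sub_eq_zero_of_le hT, zero_mul, zero_mul]
          · refine Nat.mul_le_mul_left _ ?_
            rcases card_le_one_iff_subset_singleton.1 (Nat.le_of_lt_succ hT) with ⟨j, hj⟩
            rcases subset_singleton_iff.1 hj with rfl | rfl
            · exact h.traceCount_empty_le
            · exact Nat.le_of_lt_succ (hall j)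
      _ = 14 := by decide +kernel
  rw [hexcess, compl_empty, card_univ, Fintype.card_fin] at hcount
  omega

lemma three_le_traceCount_five (h : IsRareTransversal F x e) (hF : #F ≤ 113) (z : Fin 5) :
    3 ≤ traceCount F e {z} := by
  by_contra! hz
  obtain ⟨y, hy⟩ := h.exists_three_le_traceCount_five hF
  have hyz : y ≠ z := by rintro rfl; omega
  obtain ⟨w, hwx, hw⟩ := exists_variesAt hy x
  obtain ⟨k, hky, hk⟩ := h.exists_ne_forall_two_le_traceCount hw
    (h.card_forcedIndices_le_one_of_five hF hwx hw)
  have hcount := h.three_mul_sum_sdiff_singleton_tsub_one_mul_le z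
    (fun T => if y ∈ T ∧ k ∉ T then 2 else 1) fun T hT => by
      split_ifs with hT'
      · exact hk T hT'.1 hT'.2
      · exact h.one_le_traceCount hT
  have hweight := sum_sdiff_five z y k hyz hky
  rw [Fintype.card_fin] at hcount
  omega

lemma card_ge_of_five (h : IsRareTransversal F x e) : 114 ≤ #F := by
  by_contra! hlt
  have hF : #F ≤ 113 := by omega
  obtain ⟨g, hg, hgT⟩ := h.exists_map_forall_two_le_traceCount (h.three_le_traceCount_five hF)
    fun w j hwx hw => h.card_forcedIndices_le_one_of_five hF hwx hw
  have hcount := h.three_mul_sum_card_tsub_one_mul_le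
    (fun T => if T.image g ⊆ T then 1 else 2) fun T hT => by
      split_ifs with hclosed
      · exact h.one_le_traceCount hT
      · exact hgT T hclosed
  have hweight := sum_closed_five g hg
  rw [Fintype.card_fin] at hcount
  omega

end Five

lemma card_ge_of_six {e : Fin 6 → α} (h : IsRareTransversal F x e) : 127 ≤ #F := by
  have hcount := h.three_mul_sum_card_tsub_one_mul_le (fun _ => 1)
    fun T hT => h.one_le_traceCount hT
  have hweight : ∑ T : Finset (Fin 6), (#T - 1) * 1 = 129 := by decide +kernel
  rw [hweight, Fintype.card_fin] at hcount
  omega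

lemma two_pow_card_le {ι : Type*} [Fintype ι] {e : ι → α} (h : IsRareTransversal F x e) :
    2 ^ Fintype.card ι ≤ #F + 1 := by
  classical
  have hsub : ((univ : Finset ι).powerset.erase ∅) ⊆ F.image (indexTrace e) := fun T hT => by
    obtain ⟨A, hA, hAT⟩ := h.exists_mem (nonempty_iff_ne_empty.2 (ne_of_mem_erase hT))
    exact mem_image.2 ⟨A, hA, hAT⟩
  have hcard := (card_le_card hsub).trans card_image_le
  rw [card_erase_of_mem (empty_mem_powerset _), card_powerset, card_univ] at hcard
  omega

lemma not_isRareTransversal_three (e : Fin 3 → α) : ¬ IsRareTransversal F x e := by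
  intro h
  have hcount := h.three_mul_sum_card_tsub_one_mul_le (fun _ => 1)
    fun T hT => h.one_le_traceCount hT
  have hweight : ∑ T : Finset (Fin 3), (#T - 1) * 1 = 5 := by decide +kernel
  rw [hweight, Fintype.card_fin] at hcount
  omega

lemma not_isRareTransversal_two (e : Fin 2 → α) : ¬ IsRareTransversal F x e := by
  intro h
  have hcount := h.three_mul_sum_card_tsub_one_mul_le (fun _ => 1)
    fun T hT => h.one_le_traceCount hT
  have hcount₀ := h.three_mul_sum_tsub_mul_le {1} 0 (fun _ => 1)
    fun T hT => h.one_le_traceCount hT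
  have hweight : ∑ T : Finset (Fin 2), (#T - 1) * 1 = 1 := by decide +kernel
  have hweight₀ : ∑ T : Finset (Fin 2), (#(T \ {1}) - 0) * 1 = 2 := by decide +kernel
  rw [hweight, Fintype.card_fin] at hcount
  simp only [hweight₀, card_compl, Fintype.card_fin, card_singleton, zero_tsub, zero_mul,
    sum_const_zero] at hcount₀
  omega

lemma filter_notMem_subset_of_one {e : Fin 1 → α} (h : IsRareTransversal F x e) :
    {A ∈ F | e 0 ∉ A} ⊆ {∅, {x}} := by
  intro A hA
  obtain ⟨hA, h0⟩ := mem_filter.1 hA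
  by_contra hne
  simp only [mem_insert, mem_singleton, not_or] at hne
  obtain ⟨i, hi⟩ := h.meets A hA hne.1 hne.2
  rw [mem_indexTrace, Subsingleton.elim i 0] at hi
  exact h0 hi

lemma isNearTwoCube_of_one {e : Fin 1 → α} (h : IsRareTransversal F x e) : IsNearTwoCube F := by
  obtain ⟨U, hU, hUe⟩ := h.exists_private 0
  have hUe : e 0 ∈ U := by rw [← mem_indexTrace (e := e), hUe]; exact mem_singleton_self _
  have hUmem : U ∈ ({A ∈ F | e 0 ∈ A} : Finset (Finset α)) := mem_filter.2 ⟨hU, hUe⟩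
  have hrare : 3 * #{A ∈ F | e 0 ∈ A} ≤ #F := h.count_le _ (h.ne_apex 0)
  have hsplit : #{A ∈ F | e 0 ∈ A} + #{A ∈ F | e 0 ∉ A} = #F := card_filter_add_card_filter_not _
  have hpos : 0 < #{A ∈ F | e 0 ∈ A} := card_pos.2 ⟨U, hUmem⟩
  have hle := (card_le_card h.filter_notMem_subset_of_one).trans card_le_two
  have havoid : {A ∈ F | e 0 ∉ A} = {∅, {x}} :=
    eq_of_subset_of_card_le h.filter_notMem_subset_of_one (card_le_two.trans (by omega))
  have hcontain : {A ∈ F | e 0 ∈ A} = {U} :=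
    (eq_of_subset_of_card_le (singleton_subset_iff.2 hUmem)
      (by rw [card_singleton]; omega)).symm
  have hxF : {x} ∈ F :=
    mem_of_mem_filter _ (havoid ▸ mem_insert_of_mem (mem_singleton_self {x}))
  have hxU : {x} ∪ U = U := by
    rw [← mem_singleton, ← hcontain, mem_filter]
    exact ⟨h.union_mem _ hxF _ hU, mem_union_right _ hUe⟩
  refine ⟨x, U, (union_eq_right.1 hxU).ssubset_of_ne fun hx => h.ne_apex 0 ?_, ?_⟩
  · rwa [← hx, mem_singleton] at hUe
  · rw [← filter_union_filter_not_eq (fun A => e 0 ∈ A) F, hcontain, havoid, union_comm]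
    rfl

lemma card_groundSet_le_one_of_zero {e : Fin 0 → α} (h : IsRareTransversal F x e) :
    #(groundSet F) ≤ 1 := by
  refine (card_le_card (t := {x}) fun y hy => ?_).trans (card_singleton x).le
  obtain ⟨A, hA, hy⟩ := mem_biUnion.1 hy
  by_contra hyx
  obtain ⟨i, -⟩ := h.meets A hA (ne_empty_of_mem hy) (by rintro rfl; exact hyx hy)
  exact i.elim0

theorem card_ge_and_eq_four {s : ℕ} {e : Fin s → α} (h : IsRareTransversal F x e)
    (hground : 2 ≤ #(groundSet F)) (hcube : ¬ IsNearTwoCube F) (hF : #F ≤ 113) :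
    81 ≤ #F ∧ s = 4 := by
  rcases le_or_gt 7 s with hs | hs
  · have hpow := h.two_pow_card_le
    have : 2 ^ 7 ≤ 2 ^ s := Nat.pow_le_pow_right two_pos hs
    rw [Fintype.card_fin] at hpow
    omega
  interval_cases s
  · have := h.card_groundSet_le_one_of_zero
    omega
  · exact absurd h.isNearTwoCube_of_one hcube
  · exact (not_isRareTransversal_two e h).elim
  · exact (not_isRareTransversal_three e h).elim
  · exact ⟨h.card_ge_of_four, rfl⟩
  · have := h.card_ge_of_five
    omega
  · have := h.card_ge_of_six
    omega

end IsRareTransversal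

section Frequencies

variable {α : Type*} [DecidableEq α] {F : Finset (Finset α)} {x y : α}

lemma countP_getD_lt_le {β : Type*} [Preorder β] [DecidableLT β] {l : List β}
    (hl : l.Pairwise (· ≥ ·)) (k : ℕ) (d : β) : l.countP (l.getD k d < ·) ≤ k := by
  induction l generalizing k with
  | nil => simp
  | cons a l ih =>
    obtain ⟨ha, hl⟩ := List.pairwise_cons.1 hl
    cases k with
    | zero => simpa [List.countP_eq_zero] using fun b hb => (ha b hb).not_gt
    | succ k =>
      rw [List.getD_cons_succ, List.countP_cons]
      have := ih hl k
      split_ifs <;> omega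

lemma card_filter_getD_sortedCounts_lt_le (F : Finset (Finset α)) (k : ℕ) :
    #{z ∈ groundSet F | (sortedCounts F).getD k 0 < setCount F z} ≤ k := by
  have hcoe : ((sortedCounts F : List ℕ) : Multiset ℕ) = (groundSet F).val.map (setCount F) :=
    Multiset.sort_eq _ _
  have hsorted : (sortedCounts F).Pairwise (· ≥ ·) := Multiset.pairwise_sort _ _
  have h := countP_getD_lt_le hsorted k 0
  rwa [← Multiset.coe_countP, hcoe, Multiset.countP_map] at h

lemma setCount_eq_zero (hy : y ∉ groundSet F) : setCount F y = 0 :=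
  card_eq_zero.2 <| filter_eq_empty_iff.2 fun A hA hyA => hy (mem_biUnion.2 ⟨A, hA, hyA⟩)

lemma IsMostFrequent.setCount_le_getD_sortedCounts (hx : IsMostFrequent F x) (hyx : y ≠ x) :
    setCount F y ≤ (sortedCounts F).getD 1 0 := by
  by_cases hy : y ∈ groundSet F
  · by_contra! hlt
    refine (card_filter_getD_sortedCounts_lt_le F 1).not_gt ?_
    exact one_lt_card.2 ⟨x, mem_filter.2 ⟨hx.1, hlt.trans_le (hx.2 y hy)⟩, y,
      mem_filter.2 ⟨hy, hlt⟩, hyx.symm⟩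
  · exact (setCount_eq_zero hy).trans_le (Nat.zero_le _)

lemma IsMostFrequent.three_mul_setCount_le (hx : IsMostFrequent F x)
    (hfreq : kthFrequency 2 F ≤ 1 / 3) (hyx : y ≠ x) : 3 * setCount F y ≤ #F := by
  have hF : (0 : ℚ) < #F := by
    obtain ⟨A, hA, -⟩ := mem_biUnion.1 hx.1
    exact Nat.cast_pos.2 (card_pos.2 ⟨A, hA⟩)
  rw [kthFrequency, div_le_iff₀ hF] at hfreq
  have hsecond : 3 * (sortedCounts F).getD 1 0 ≤ #F := by
    rw [← Nat.cast_le (α := ℚ)]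
    push_cast
    linarith
  linarith [hx.setCount_le_getD_sortedCounts hyx]

lemma exists_isMostFrequent (h : (groundSet F).Nonempty) : ∃ x, IsMostFrequent F x :=
  exists_max_image (groundSet F) (setCount F) h

end Frequencies

section MinimalTwoGood

variable {α : Type*} [DecidableEq α] {F : Finset (Finset α)} {x : α}

lemma isTwoGood_erase_groundSet (F : Finset (Finset α)) (x : α) :
    IsTwoGood F x ((groundSet F).erase x) := by
  refine ⟨notMem_erase _ _, fun A hA h0 hx hd => ?_⟩
  have hsub : A ⊆ {x} := fun y hy => by
    by_contra hyx
    exact notMem_empty y (hd ▸ mem_inter.2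
      ⟨mem_erase.2 ⟨mt mem_singleton.2 hyx, mem_biUnion.2 ⟨A, hA, hy⟩⟩, hy⟩)
  exact (subset_singleton_iff.1 hsub).elim h0 hx

lemma exists_isMinimalTwoGood (F : Finset (Finset α)) (x : α) : ∃ S, IsMinimalTwoGood F x S := by
  obtain ⟨S, hS⟩ := exists_minimal_of_wellFoundedLT (IsTwoGood F x)
    ⟨_, isTwoGood_erase_groundSet F x⟩
  exact ⟨S, hS.prop, fun T hT => hS.not_prop_of_lt hT⟩

lemma IsMinimalTwoGood.exists_inter_eq_singleton {S : Finset α} (hS : IsMinimalTwoGood F x S)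
    {y : α} (hy : y ∈ S) : ∃ A ∈ F, S ∩ A = {y} := by
  have hsmaller := hS.2 _ (erase_ssubset hy)
  simp only [IsTwoGood, not_and, not_forall, not_not] at hsmaller
  obtain ⟨A, hA, h0, hx, hd⟩ := hsmaller fun h => hS.1.1 (mem_of_mem_erase h)
  rw [erase_inter, erase_eq_empty_iff] at hd
  exact ⟨A, hA, hd.resolve_left (hS.1.2 A hA h0 hx)⟩

lemma IsMinimalTwoGood.isRareTransversal (hF : ∀ A ∈ F, ∀ B ∈ F, A ∪ B ∈ F)
    (hcount : ∀ y, y ≠ x → 3 * setCount F y ≤ #F) {S : Finset α} (hS : IsMinimalTwoGood F x S) :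
    IsRareTransversal F x (fun i => (S.equivFin.symm i : α)) := by
  refine ⟨hF, hcount, fun i hi => hS.1.1 (hi ▸ (S.equivFin.symm i).2), fun A hA h0 hx => ?_,
    fun i => ?_⟩
  · obtain ⟨y, hy⟩ := nonempty_iff_ne_empty.2 (hS.1.2 A hA h0 hx)
    obtain ⟨hyS, hyA⟩ := mem_inter.1 hy
    exact ⟨S.equivFin ⟨y, hyS⟩, by simpa using hyA⟩
  · obtain ⟨A, hA, hSA⟩ := hS.exists_inter_eq_singleton (S.equivFin.symm i).2
    refine ⟨A, hA, ext fun j => ?_⟩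
    have hj := Finset.ext_iff.1 hSA (S.equivFin.symm j)
    simpa [Subtype.val_inj] using hj

end MinimalTwoGood

theorem mainTheorem1 {α : Type*} [DecidableEq α] (F : Finset (Finset α))
    (hF : ∀ A ∈ F, ∀ B ∈ F, A ∪ B ∈ F)
    (hground : 2 ≤ #(groundSet F))
    (hcube : ¬ IsNearTwoCube F)
    (hfreq : kthFrequency 2 F ≤ 1 / 3) :
    (81 ≤ #F ∧ #F ≤ 113) ∧
      ∀ x : α, IsMostFrequent F x → ∀ S : Finset α, IsMinimalTwoGood F x S → #S = 4 := by
  have hcount : ∀ x, IsMostFrequent F x → ∀ y ≠ x, 3 * setCount F y ≤ #F :=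
    fun x hx y hyx => hx.three_mul_setCount_le hfreq hyx
  have hle : ∀ x, IsMostFrequent F x → #F ≤ 113 :=
    fun x hx => card_le_of_three_mul_setCount_le hF (hcount x hx)
  have hge : ∀ x, IsMostFrequent F x → ∀ S, IsMinimalTwoGood F x S → 81 ≤ #F ∧ #S = 4 :=
    fun x hx S hS =>
      (hS.isRareTransversal hF (hcount x hx)).card_ge_and_eq_four hground hcube (hle x hx)
  obtain ⟨x, hx⟩ := exists_isMostFrequent (F := F) (card_pos.1 (by omega))
  obtain ⟨S, hS⟩ := exists_isMinimalTwoGood F x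
  exact ⟨⟨(hge x hx S hS).1, hle x hx⟩, fun x hx S hS => (hge x hx S hS).2⟩
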